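/- **Data.** Let $\Bbbk$ be a field and fix a simply-laced Cartan datum: an index set $I$, a free $\mathbb Z$-module $X$ with a symmetric ($\mathbb Q$-valued) bilinear form $(\cdot,\cdot)$, elements $\alpha_i,\Lambda_i\in X$ and $h_i\in\mathrm{Hom}(X,\mathbb Z)$ for $i\in I$, with $(\alpha_i,\alpha_i)=2$, $i\cdot j:=(\alpha_i,\alpha_j)\in\{0,-1\}$ for $i\ne j$, $\lambda_i:=\langle h_i,\lambda\rangle=(\alpha_i,\lambda)$, and $\langle h_j,\Lambda_i\rangle=\delta_{ij}$. A *choice of scalars* $Q$ is a family $t_{ij}\in\Bbbk^\times$ ($i\neq j$) with $t_{ij}=t_{ji}$ if $i\cdot j=0$. *Bubble parameters compatible with $Q$* are $\beta_{i,\lambda},\mathsf c^{+}_{i,\lambda},\mathsf c^-_{i,\lambda}\in\Bbbk^\times$ ($i\in I,\lambda\in X$) with $\mathsf c^+_{i,\lambda}\mathsf c^-_{i,\lambda}=-1/\beta_{i,\lambda}$, $\ \mathsf c^{\pm}_{i,\lambda\pm\alpha_j}=t_{ij}\mathsf c^{\pm}_{i,\lambda}$ for $j\ne i$, and $\mathsf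 c^{\pm}_{i,\lambda\pm\alpha_i}=-\beta_{i,\lambda}\mathsf c^{\pm}_{i,\lambda}$. **The 2-category $\mathcal U_{Q,\beta}(\mathfrak g)$.** Objects are the $\lambda\in X$. 1-morphisms are formal finite direct sums of grading shifts $x\langle t\rangle$ of words $x$ in $\mathcal E_i\mathbb 1_\lambda:\lambda\to\lambda+\alpha_i$ and $\mathcal F_i\mathbb 1_\lambda:\lambda\to\lambda-\alpha_i$. 2-morphisms $x\langle s\rangle\to y\langle t\rangle$ are the $\Bbbk$-linear combinations of diagrams $x\to y$ of degree $t-s$ (and matrices of such), generated by - the dot $\mathcal E_i\mathbb 1_\lambda\to\mathcal E_i\mathbb 1_\lambda$ of degree $i\cdot i$ and the crossing $\mathcal E_i\mathcal E_j\mathbb 1_\lambda\to\mathcal E_j\mathcal E_i\mathbb 1_\lambda$ of degree $-i\cdot j$, - the cups $\eta_{i,\lambda}:\mathbb 1_\lambda\to\mathcal F_i\mathcal E_i\mathbb 1_\lambda$ and caps $\varepsilon_{i,\lambda}:\mathcal F_i\mathcal E_i\mathbb 1_\lambda\to\mathbb 1_\lambda$ of degree $1+\lambda_i$, - the cups $\eta'_{i,\lambda}:\mathbb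 1_\lambda\to\mathcal E_i\mathcal F_i\mathbb 1_\lambda$ and caps $\varepsilon'_{i,\lambda}:\mathcal E_i\mathcal F_i\mathbb 1_\lambda\to\mathbb 1_\lambda$ of degree $1-\lambda_i$, modulo the following local relations. 1. The caps and cups satisfy the four zigzag identities making $\mathcal E_i\mathbb 1_\lambda$ and $\mathcal F_i\mathbb 1_{\lambda+\alpha_i}$ biadjoint. 2. Cyclicity: the left and the right mate of the dot agree, and so do the two full rotations of the crossing. The downward dot is the mate of the dot. The sideways crossings $\sigma_{ij}:\mathcal E_i\mathcal F_j\to\mathcal F_j\mathcal E_i$ and $\sigma'_{ij}:\mathcal F_i\mathcal E_j\to\mathcal E_j\mathcal F_i$ are the upward crossing $\mathcal E_j\mathcal E_i\to\mathcal E_i\mathcal E_j$ rotated, with $\eta_j,\varepsilon'_j$ and with $\eta'_i,\varepsilon_i$ respectively. 3. KLR relations. The composite $\mathcal E_i\mathcal E_j\to\mathcal E_j\mathcal E_i\to\mathcal E_i\mathcal E_j$ of two crossings is $0$ if $i=j$, is $t_{ij}\,\mathrm{id}$ if $i\cdot j=0$, and is $t_{ij}(\text{dot on }\mathcal E_i)+t_{ji}(\text{dot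 on }\mathcal E_j)$ if $i\cdot j=-1$. Dots slide through the crossing of $i\ne j$. For $i=j$, both (crossing with a dot on its bottom left end) $-$ (crossing with a dot on its top right end) and (crossing with a dot on its top left end) $-$ (crossing with a dot on its bottom right end) are the identity. The two triple crossings on $\mathcal E_i\mathcal E_j\mathcal E_k$ are equal unless $i=k$ and $i\cdot j=-1$, when (middle strand passing on the left) $-$ (middle strand passing on the right) $=t_{ij}\,\mathrm{id}$. 4. For $i\neq j$, the composites $\mathcal F_j\mathcal E_i\to\mathcal E_i\mathcal F_j\to\mathcal F_j\mathcal E_i$ and $\mathcal E_i\mathcal F_j\to\mathcal F_j\mathcal E_i\to\mathcal E_i\mathcal F_j$ of sideways crossings are identities. 5. Write $b^{+}_{i,m}$ for the clockwise bubble ($\eta'_{i,\lambda}$, then $m\ge 0$ dots on $\mathcal E_i$, then $\varepsilon'_{i,\lambda}$) and $b^-_{i,m}$ for the counterclockwise one ($\eta_{i,\lambda}$, $m$ dots, $\varepsilon_{i,\lambda}$). Then $b^\pm_{i,m}=0$ if $m<\pm\lambda_i-1$. Put $B^\pm_{i,j}=b^\pm_{i,\pm\lambda_i-1+j}$ whenever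 $\pm\lambda_i-1+j\ge0$; the remaining $B^\pm_{i,j}$, $j\ge 0$, are formal symbols ("fake bubbles") of degree $2j$. Then $B^{\pm}_{i,0}=\mathsf c^\pm_{i,\lambda}\mathrm{id}$ and $\big(\sum_{j}B^+_{i,j}t^j\big)\big(\sum_jB^-_{i,j}t^j\big)=-1/\beta_{i,\lambda}$, which determines the fake bubbles. 6. $\mathfrak{sl}_2$ relations at $\lambda$: $\ \mathrm{id}_{\mathcal E_i\mathcal F_i\mathbb 1_\lambda}=\beta_{i,\lambda}\,\sigma'_{ii}\sigma_{ii}-\beta_{i,\lambda}\sum_{f_1+f_2+f_3=\lambda_i-1}(\eta'_{i,\lambda}\text{ with }f_3\text{ dots})\,B^-_{i,f_2}\,(\varepsilon'_{i,\lambda}\text{ with }f_1\text{ dots})$, and $\ \mathrm{id}_{\mathcal F_i\mathcal E_i\mathbb 1_\lambda}=\beta_{i,\lambda}\,\sigma_{ii}\sigma'_{ii}-\beta_{i,\lambda}\sum_{f_1+f_2+f_3=-\lambda_i-1}(\eta_{i,\lambda}\text{ with }f_3\text{ dots})\,B^+_{i,f_2}\,(\varepsilon_{i,\lambda}\text{ with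 }f_1\text{ dots})$, the sums being over $f_1,f_2,f_3\ge0$. The cyclic 2-category $\mathcal U^{cyc}_Q(\mathfrak g)$ is this 2-category for compatible bubble parameters with all $\beta_{i,\lambda}=-1$; one writes $c_{i,\lambda}:=\mathsf c^+_{i,\lambda}$ for its parameters, so that $\mathsf c^-_{i,\lambda}=c_{i,\lambda}^{-1}$. **Theorem.** Let $\mathcal U^{cyc}_Q(\mathfrak g)$ be given by parameters $c_{i,\lambda}$ and let $\beta=(\beta_{i,\lambda},\mathsf c^\pm_{i,\lambda})$ be any bubble parameters compatible with the same $Q$. There is an isomorphism $\digamma:\mathcal U_Q^{cyc}(\mathfrak g)\to\mathcal U_{Q,\beta}(\mathfrak g)$ of graded additive $\Bbbk$-linear 2-categories which is the identity on objects and 1-morphisms, sends upward dots to upward dots and upward crossings to upward crossings, and satisfies $$\digamma(\varepsilon'_{i,\lambda})=\begin{cases}\frac{c_{i,\lambda}}{\mathsf c^+_{i,\lambda}}\,\varepsilon'_{i,\lambda}&\lambda_i\equiv0,1\ (4)\\ c_{i,\lambda}\,\varepsilon'_{i,\lambda}&\text{otherwise,}\end{cases}\qquad \digamma(\varepsilon_{i,\lambda})=\begin{cases}\frac{1}{\mathsf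 c^-_{i,\lambda}}\,\varepsilon_{i,\lambda}&\lambda_i\equiv0,1\ (4)\\ \varepsilon_{i,\lambda}&\text{otherwise,}\end{cases}$$ $$\digamma(\eta'_{i,\lambda})=\begin{cases}\frac{1}{\mathsf c^+_{i,\lambda}}\,\eta'_{i,\lambda}&\lambda_i\equiv2,3\ (4)\\ \eta'_{i,\lambda}&\text{otherwise,}\end{cases}\qquad \digamma(\eta_{i,\lambda})=\begin{cases}\frac{c_{i,\lambda}^{-1}}{\mathsf c^-_{i,\lambda}}\,\eta_{i,\lambda}&\lambda_i\equiv2,3\ (4)\\ c_{i,\lambda}^{-1}\,\eta_{i,\lambda}&\text{otherwise.}\end{cases}$$ -/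

import Mathlib

open CategoryTheory

noncomputable section

namespace CatQG

universe u₁ u₂ u₃

/-- A simply-laced (symmetric) Cartan datum with index set `I` and weight lattice `X`. The form
takes rational values, as it does on the weight lattice of a finite type root system. -/
structure CartanDatum (I : Type u₂) (X : Type u₃) [AddCommGroup X] where
  /-- simple roots -/
  α : I → X
  /-- fundamental weights -/
  Λ : I → X
  /-- simple coroots -/
  h : I → Module.Dual ℤ X
  form : X →ₗ[ℤ] X →ₗ[ℤ] ℚ
  form_symm : ∀ x y, form x y = form y x
  form_self : ∀ i, form (α i) (α i) = 2
  form_of_ne : ∀ i j, i ≠ j → form (α i) (α j) = 0 ∨ form (α i) (α j) = -1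
  h_eq_form : ∀ i x, (h i x : ℚ) = form (α i) x
  h_fund_self : ∀ i, h i (Λ i) = 1
  h_fund_of_ne : ∀ i j, i ≠ j → h j (Λ i) = 0

/-- The Cartan integer `i · j = (αᵢ, αⱼ) = ⟨hᵢ, αⱼ⟩`. -/
def CartanDatum.a {I : Type u₂} {X : Type u₃} [AddCommGroup X] (D : CartanDatum I X) (i j : I) :
    ℤ := D.h i (D.α j)

/-- A choice of scalars `Q`. Only the values `t i j` with `i ≠ j` are ever used. -/
structure Scalars (𝕜 : Type u₁) [Field 𝕜] {I : Type u₂} {X : Type u₃} [AddCommGroup X]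
    (D : CartanDatum I X) where
  t : I → I → 𝕜ˣ
  t_symm : ∀ i j, D.a i j = 0 → t i j = t j i

/-- Bubble parameters compatible with the scalars `Q`: the parameters `β`, `c⁺`, `c⁻`. The
conditions on `c±` are those of `c±(i, λ ± αⱼ) = t i j * c±(i, λ)` with the convention
`t i i = - β i`. -/
structure BubbleParams {𝕜 : Type u₁} [Field 𝕜] {I : Type u₂} {X : Type u₃} [AddCommGroup X]
    {D : CartanDatum I X} (Q : Scalars 𝕜 D) where
  β : I → X → 𝕜ˣ
  cp : I → X → 𝕜ˣ
  cm : I → X → 𝕜ˣ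
  cp_mul_cm : ∀ i x, cp i x * cm i x = -(β i x)⁻¹
  cp_add_of_ne : ∀ i j x, i ≠ j → cp i (x + D.α j) = Q.t i j * cp i x
  cp_add_self : ∀ i x, cp i (x + D.α i) = -β i x * cp i x
  cm_sub_of_ne : ∀ i j x, i ≠ j → cm i (x - D.α j) = Q.t i j * cm i x
  cm_sub_self : ∀ i x, cm i (x - D.α i) = -β i x * cm i x

/-- The parameters of the cyclic 2-category `U_Q^cyc`: all `β` are `-1`. Then `c⁻ = (c⁺)⁻¹`, and
`c := c⁺` is constant along root strings. -/
def BubbleParams.IsCyclic {𝕜 : Type u₁} [Field 𝕜] {I : Type u₂} {X : Type u₃} [AddCommGroup X]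
    {D : CartanDatum I X} {Q : Scalars 𝕜 D} (B : BubbleParams Q) : Prop :=
  ∀ i x, B.β i x = -1

/-- The letters `E i` and `F i`. -/
inductive Letter (I : Type u₂) : Type u₂
  | E (i : I)
  | F (i : I)

/-- Compositions of the generating 1-morphisms; as in diagrams, the rightmost letter acts first. -/
abbrev Word (I : Type u₂) := List (Letter I)

open Letter

section Terms

variable {I : Type u₂} {X : Type u₃} [AddCommGroup X]

/-- The weight of a word `w`: `w` is a 1-morphism from `x` to `x + wt w`. -/
def CartanDatum.wt (D : CartanDatum I X) : Word I → X
  | [] => 0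
  | E i :: w => D.α i + D.wt w
  | F i :: w => -D.α i + D.wt w

theorem CartanDatum.wt_append (D : CartanDatum I X) (u v : Word I) :
    D.wt (u ++ v) = D.wt u + D.wt v := by
  induction u with
  | nil => simp [wt]
  | cons a u ih => cases a <;> simp [wt, ih, add_assoc]

/-- Formal linear combinations of diagrams, read from bottom to top, with bottom boundary `u` and
top boundary `v`. The weights of the regions are not recorded: they are determined by the weight of
the rightmost region. `eqHom` is the identity of a word, and `wl`, `wr` put vertical strands to the
left and to the right of a diagram. The symbols `cwStar i j` and `ccwStar i j` stand for the
(possibly fake) bubbles of degree `2 * j`, with `λᵢ - 1 + j` and `-λᵢ - 1 + j` dots; the relations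
below make them equal to genuine bubbles when the number of dots is not negative, and determine
them by the infinite Grassmannian relation otherwise. -/
inductive Term (𝕜 : Type u₁) (I : Type u₂) : Word I → Word I → Type (max u₁ u₂)
  | eqHom {u v : Word I} (h : u = v) : Term 𝕜 I u v
  | comp {u v w : Word I} (f : Term 𝕜 I u v) (g : Term 𝕜 I v w) : Term 𝕜 I u w
  | wl (a : Word I) {u v : Word I} (f : Term 𝕜 I u v) : Term 𝕜 I (a ++ u) (a ++ v)
  | wr {u v : Word I} (f : Term 𝕜 I u v) (b : Word I) : Term 𝕜 I (u ++ b) (v ++ b)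
  | zero {u v : Word I} : Term 𝕜 I u v
  | add {u v : Word I} (f g : Term 𝕜 I u v) : Term 𝕜 I u v
  | smul {u v : Word I} (c : 𝕜) (f : Term 𝕜 I u v) : Term 𝕜 I u v
  | dot (i : I) : Term 𝕜 I [E i] [E i]
  | cross (i j : I) : Term 𝕜 I [E i, E j] [E j, E i]
  | cupFE (i : I) : Term 𝕜 I [] [F i, E i]
  | cupEF (i : I) : Term 𝕜 I [] [E i, F i]
  | capFE (i : I) : Term 𝕜 I [F i, E i] []
  | capEF (i : I) : Term 𝕜 I [E i, F i] []
  | cwStar (i : I) (j : ℕ) : Term 𝕜 I [] []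
  | ccwStar (i : I) (j : ℕ) : Term 𝕜 I [] []

namespace Term

variable {𝕜 : Type u₁}

/-- The identity of a word. -/
def one (u : Word I) : Term 𝕜 I u u := eqHom rfl

/-- Powers with respect to vertical composition. -/
def npow {u : Word I} (f : Term 𝕜 I u u) : ℕ → Term 𝕜 I u u
  | 0 => one u
  | n + 1 => (f.npow n).comp f

/-- Finite sums. -/
def sum {u v : Word I} : List (Term 𝕜 I u v) → Term 𝕜 I u v
  | [] => zero
  | f :: l => f.add (sum l)

/-- The clockwise bubble with `m` dots. -/
def cwBubble (i : I) (m : ℕ) : Term 𝕜 I [] [] :=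
  (cupEF i).comp ((((dot i).npow m).wr [F i]).comp (capEF i))

/-- The counterclockwise bubble with `m` dots. -/
def ccwBubble (i : I) (m : ℕ) : Term 𝕜 I [] [] :=
  (cupFE i).comp ((((dot i).npow m).wl [F i]).comp (capFE i))

/-- The dot on a downward strand: the mate of the dot under `capFE`, `cupEF`. -/
def downDot (i : I) : Term 𝕜 I [F i] [F i] :=
  ((cupEF i).wl [F i]).comp ((((dot i).wr [F i]).wl [F i]).comp ((capFE i).wr [F i]))

/-- The other mate of the dot, under `cupFE`, `capEF`. -/
def downDot' (i : I) : Term 𝕜 I [F i] [F i] :=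
  ((cupFE i).wr [F i]).comp ((((dot i).wr [F i]).wl [F i]).comp ((capEF i).wl [F i]))

/-- The downward crossing: the upward crossing rotated by nested cups on the left and nested caps
on the right. -/
def downCross (i j : I) : Term 𝕜 I [F i, F j] [F j, F i] :=
  ((cupFE j).wr [F i, F j]).comp
    ((((cupFE i).wr [E j, F i, F j]).wl [F j]).comp
      ((((cross i j).wr [F i, F j]).wl [F j, F i]).comp
        ((((capEF i).wr [F j]).wl [F j, F i, E j]).comp
          ((capEF j).wl [F j, F i]))))

/-- The upward crossing rotated by nested cups on the right and nested caps on the left. -/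
def downCross' (i j : I) : Term 𝕜 I [F i, F j] [F j, F i] :=
  ((cupEF i).wl [F i, F j]).comp
    ((((cupEF j).wr [F i]).wl [F i, F j, E i]).comp
      ((((cross i j).wr [F j, F i]).wl [F i, F j]).comp
        ((((capFE j).wr [E i, F j, F i]).wl [F i]).comp
          ((capFE i).wr [F j, F i]))))

/-- The sideways crossing `Eᵢ Fⱼ → Fⱼ Eᵢ`. -/
def sideEF (i j : I) : Term 𝕜 I [E i, F j] [F j, E i] :=
  ((cupFE j).wr [E i, F j]).comp
    ((((cross j i).wr [F j]).wl [F j]).comp ((capEF j).wl [F j, E i]))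

/-- The sideways crossing `Fᵢ Eⱼ → Eⱼ Fᵢ`. -/
def sideFE (i j : I) : Term 𝕜 I [F i, E j] [E j, F i] :=
  ((cupEF i).wl [F i, E j]).comp
    ((((cross j i).wr [F i]).wl [F i]).comp ((capFE i).wr [E j, F i]))

/-- The side of the braid relation on `Eᵢ Eⱼ Eₖ` in which the middle strand passes on the left. -/
def braidL (i j k : I) : Term 𝕜 I [E i, E j, E k] [E k, E j, E i] :=
  ((cross i j).wr [E k]).comp (((cross i k).wl [E j]).comp ((cross j k).wr [E i]))

/-- The other side of the braid relation: the middle strand passes on the right. -/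
def braidR (i j k : I) : Term 𝕜 I [E i, E j, E k] [E k, E j, E i] :=
  ((cross j k).wl [E i]).comp (((cross i k).wr [E j]).comp ((cross i j).wl [E k]))

/-- The triples `(f₁, f₂, f₃)` of natural numbers with `f₁ + f₂ + f₃ = m`. -/
def triples (m : ℤ) : List (Fin 3 → ℕ) :=
  if 0 ≤ m then List.Nat.antidiagonalTuple 3 m.toNat else []

/-- The sum over `f₁ + f₂ + f₃ = m` in the decomposition of `Eᵢ Fᵢ`. -/
def sumEF (i : I) (m : ℤ) : Term 𝕜 I [E i, F i] [E i, F i] :=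
  sum ((triples m).map fun f =>
    (((downDot i).npow (f 0)).wl [E i]).comp ((capEF i).comp ((ccwStar i (f 1)).comp
      ((cupEF i).comp (((downDot i).npow (f 2)).wl [E i])))))

/-- The sum over `f₁ + f₂ + f₃ = m` in the decomposition of `Fᵢ Eᵢ`. -/
def sumFE (i : I) (m : ℤ) : Term 𝕜 I [F i, E i] [F i, E i] :=
  sum ((triples m).map fun f =>
    (((dot i).npow (f 0)).wl [F i]).comp ((capFE i).comp ((cwStar i (f 1)).comp
      ((cupFE i).comp (((dot i).npow (f 2)).wl [F i])))))

/-- The coefficient of `t ^ j` in the product of the generating series of the clockwise and the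
counterclockwise bubbles. -/
def grassmannian (i : I) (j : ℕ) : Term 𝕜 I [] [] :=
  sum ((List.Nat.antidiagonal j).map fun p => (cwStar i p.1).comp (ccwStar i p.2))

end Term

end Terms

section Relations

variable {𝕜 : Type u₁} [Field 𝕜] {I : Type u₂} {X : Type u₃} [AddCommGroup X]
  {D : CartanDatum I X} {Q : Scalars 𝕜 D}

open Term

/-- The relations between diagrams whose rightmost region has weight `x`. -/
inductive Rel (B : BubbleParams Q) :
    X → ∀ {u v : Word I}, Term 𝕜 I u v → Term 𝕜 I u v → Prop
  -- compatibility with the operations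
  | comp_left (x : X) {u v w : Word I} {f f' : Term 𝕜 I u v} (g : Term 𝕜 I v w) :
      Rel B x f f' → Rel B x (f.comp g) (f'.comp g)
  | comp_right (x : X) {u v w : Word I} (f : Term 𝕜 I u v) {g g' : Term 𝕜 I v w} :
      Rel B x g g' → Rel B x (f.comp g) (f.comp g')
  | wl_congr (x : X) (a : Word I) {u v : Word I} {f f' : Term 𝕜 I u v} :
      Rel B x f f' → Rel B x (f.wl a) (f'.wl a)
  | wr_congr (x : X) {u v : Word I} {f f' : Term 𝕜 I u v} (b : Word I) :
      Rel B (x + D.wt b) f f' → Rel B x (f.wr b) (f'.wr b)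
  | add_left (x : X) {u v : Word I} {f f' : Term 𝕜 I u v} (g : Term 𝕜 I u v) :
      Rel B x f f' → Rel B x (f.add g) (f'.add g)
  | add_right (x : X) {u v : Word I} (f : Term 𝕜 I u v) {g g' : Term 𝕜 I u v} :
      Rel B x g g' → Rel B x (f.add g) (f.add g')
  | smul_congr (x : X) {u v : Word I} (c : 𝕜) {f f' : Term 𝕜 I u v} :
      Rel B x f f' → Rel B x (f.smul c) (f'.smul c)
  -- vector spaces
  | add_comm (x : X) {u v : Word I} (f g : Term 𝕜 I u v) : Rel B x (f.add g) (g.add f)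
  | add_assoc (x : X) {u v : Word I} (f g h : Term 𝕜 I u v) :
      Rel B x ((f.add g).add h) (f.add (g.add h))
  | zero_add (x : X) {u v : Word I} (f : Term 𝕜 I u v) : Rel B x (zero.add f) f
  | smul_add (x : X) {u v : Word I} (c : 𝕜) (f g : Term 𝕜 I u v) :
      Rel B x ((f.add g).smul c) ((f.smul c).add (g.smul c))
  | add_smul (x : X) {u v : Word I} (c d : 𝕜) (f : Term 𝕜 I u v) :
      Rel B x (f.smul (c + d)) ((f.smul c).add (f.smul d))
  | mul_smul (x : X) {u v : Word I} (c d : 𝕜) (f : Term 𝕜 I u v) :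
      Rel B x (f.smul (c * d)) ((f.smul d).smul c)
  | one_smul (x : X) {u v : Word I} (f : Term 𝕜 I u v) : Rel B x (f.smul 1) f
  | zero_smul (x : X) {u v : Word I} (f : Term 𝕜 I u v) : Rel B x (f.smul 0) zero
  -- linearity of the compositions
  | add_comp (x : X) {u v w : Word I} (f f' : Term 𝕜 I u v) (g : Term 𝕜 I v w) :
      Rel B x ((f.add f').comp g) ((f.comp g).add (f'.comp g))
  | comp_add (x : X) {u v w : Word I} (f : Term 𝕜 I u v) (g g' : Term 𝕜 I v w) :
      Rel B x (f.comp (g.add g')) ((f.comp g).add (f.comp g'))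
  | smul_comp (x : X) {u v w : Word I} (c : 𝕜) (f : Term 𝕜 I u v) (g : Term 𝕜 I v w) :
      Rel B x ((f.smul c).comp g) ((f.comp g).smul c)
  | comp_smul (x : X) {u v w : Word I} (c : 𝕜) (f : Term 𝕜 I u v) (g : Term 𝕜 I v w) :
      Rel B x (f.comp (g.smul c)) ((f.comp g).smul c)
  | wl_add (x : X) (a : Word I) {u v : Word I} (f g : Term 𝕜 I u v) :
      Rel B x ((f.add g).wl a) ((f.wl a).add (g.wl a))
  | wl_smul (x : X) (a : Word I) {u v : Word I} (c : 𝕜) (f : Term 𝕜 I u v) :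
      Rel B x ((f.smul c).wl a) ((f.wl a).smul c)
  | add_wr (x : X) {u v : Word I} (f g : Term 𝕜 I u v) (b : Word I) :
      Rel B x ((f.add g).wr b) ((f.wr b).add (g.wr b))
  | smul_wr (x : X) {u v : Word I} (c : 𝕜) (f : Term 𝕜 I u v) (b : Word I) :
      Rel B x ((f.smul c).wr b) ((f.wr b).smul c)
  -- strict 2-categories
  | id_comp (x : X) {u v : Word I} (f : Term 𝕜 I u v) : Rel B x ((one u).comp f) f
  | comp_id (x : X) {u v : Word I} (f : Term 𝕜 I u v) : Rel B x (f.comp (one v)) f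
  | assoc (x : X) {u v w z : Word I} (f : Term 𝕜 I u v) (g : Term 𝕜 I v w) (h : Term 𝕜 I w z) :
      Rel B x ((f.comp g).comp h) (f.comp (g.comp h))
  | wl_id (x : X) (a u : Word I) : Rel B x ((one u).wl a) (one (a ++ u))
  | wl_comp (x : X) (a : Word I) {u v w : Word I} (f : Term 𝕜 I u v) (g : Term 𝕜 I v w) :
      Rel B x ((f.comp g).wl a) ((f.wl a).comp (g.wl a))
  | id_wr (x : X) (u b : Word I) : Rel B x ((one u).wr b) (one (u ++ b))
  | comp_wr (x : X) {u v w : Word I} (f : Term 𝕜 I u v) (g : Term 𝕜 I v w) (b : Word I) :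
      Rel B x ((f.comp g).wr b) ((f.wr b).comp (g.wr b))
  | wl_nil (x : X) {u v : Word I} (f : Term 𝕜 I u v) : Rel B x (f.wl []) f
  | wr_nil (x : X) {u v : Word I} (f : Term 𝕜 I u v) :
      Rel B x (f.wr []) ((eqHom (by simp)).comp (f.comp (eqHom (by simp))))
  | wl_append (x : X) (a b : Word I) {u v : Word I} (f : Term 𝕜 I u v) :
      Rel B x (f.wl (a ++ b)) ((eqHom (by simp)).comp (((f.wl b).wl a).comp (eqHom (by simp))))
  | wr_append (x : X) {u v : Word I} (f : Term 𝕜 I u v) (a b : Word I) :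
      Rel B x (f.wr (a ++ b)) ((eqHom (by simp)).comp (((f.wr a).wr b).comp (eqHom (by simp))))
  | wl_wr (x : X) (a : Word I) {u v : Word I} (f : Term 𝕜 I u v) (b : Word I) :
      Rel B x ((f.wr b).wl a) ((eqHom (by simp)).comp (((f.wl a).wr b).comp (eqHom (by simp))))
  | exchange (x : X) {u v u' v' : Word I} (f : Term 𝕜 I u v) (g : Term 𝕜 I u' v')
      (h : D.wt u' = D.wt v') :
      Rel B x ((f.wr u').comp (g.wl v)) ((g.wl u).comp (f.wr v'))
  -- biadjointness
  | zigzag_E (x : X) (i : I) :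
      Rel B x (((cupFE i).wl [E i]).comp ((capEF i).wr [E i])) (one [E i])
  | zigzag_F (x : X) (i : I) :
      Rel B x (((cupFE i).wr [F i]).comp ((capEF i).wl [F i])) (one [F i])
  | zigzag_E' (x : X) (i : I) :
      Rel B x (((cupEF i).wr [E i]).comp ((capFE i).wl [E i])) (one [E i])
  | zigzag_F' (x : X) (i : I) :
      Rel B x (((cupEF i).wl [F i]).comp ((capFE i).wr [F i])) (one [F i])
  -- cyclicity
  | cyclic_dot (x : X) (i : I) : Rel B x (downDot i) (downDot' i)
  | cyclic_cross (x : X) (i j : I) : Rel B x (downCross i j) (downCross' i j)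
  -- KLR relations
  | quad_self (x : X) (i : I) : Rel B x ((cross i i).comp (cross i i)) zero
  | quad_zero (x : X) (i j : I) (h : D.a i j = 0) :
      Rel B x ((cross i j).comp (cross j i)) ((one [E i, E j]).smul (Q.t i j : 𝕜))
  | quad_neg_one (x : X) (i j : I) (h : D.a i j = -1) :
      Rel B x ((cross i j).comp (cross j i))
        ((((dot i).wr [E j]).smul (Q.t i j : 𝕜)).add (((dot j).wl [E i]).smul (Q.t j i : 𝕜)))
  | nilHecke (x : X) (i : I) :
      Rel B x ((((dot i).wr [E i]).comp (cross i i)).add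
        (((cross i i).comp ((dot i).wl [E i])).smul (-1))) (one [E i, E i])
  | nilHecke' (x : X) (i : I) :
      Rel B x (((cross i i).comp ((dot i).wr [E i])).add
        ((((dot i).wl [E i]).comp (cross i i)).smul (-1))) (one [E i, E i])
  | dot_slide (x : X) (i j : I) (h : i ≠ j) :
      Rel B x (((dot i).wr [E j]).comp (cross i j)) ((cross i j).comp ((dot i).wl [E j]))
  | dot_slide' (x : X) (i j : I) (h : i ≠ j) :
      Rel B x ((cross i j).comp ((dot j).wr [E i])) (((dot j).wl [E i]).comp (cross i j))
  | braid (x : X) (i j k : I) (h : ¬(i = k ∧ D.a i j = -1)) :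
      Rel B x (braidL i j k) (braidR i j k)
  | braid_neg_one (x : X) (i j : I) (h : D.a i j = -1) :
      Rel B x ((braidL i j i).add ((braidR i j i).smul (-1)))
        ((one [E i, E j, E i]).smul (Q.t i j : 𝕜))
  -- mixed relations
  | mixed_FE (x : X) (i j : I) (h : i ≠ j) :
      Rel B x ((sideFE j i).comp (sideEF i j)) (one [F j, E i])
  | mixed_EF (x : X) (i j : I) (h : i ≠ j) :
      Rel B x ((sideEF i j).comp (sideFE j i)) (one [E i, F j])
  -- bubbles
  | cw_neg (x : X) (i : I) (m : ℕ) (h : (m : ℤ) < D.h i x - 1) : Rel B x (cwBubble i m) zero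
  | ccw_neg (x : X) (i : I) (m : ℕ) (h : (m : ℤ) < -D.h i x - 1) : Rel B x (ccwBubble i m) zero
  | cw_real (x : X) (i : I) (j m : ℕ) (h : (m : ℤ) = D.h i x - 1 + j) :
      Rel B x (cwStar i j) (cwBubble i m)
  | ccw_real (x : X) (i : I) (j m : ℕ) (h : (m : ℤ) = -D.h i x - 1 + j) :
      Rel B x (ccwStar i j) (ccwBubble i m)
  | cw_zero (x : X) (i : I) : Rel B x (cwStar i 0) ((one []).smul (B.cp i x : 𝕜))
  | ccw_zero (x : X) (i : I) : Rel B x (ccwStar i 0) ((one []).smul (B.cm i x : 𝕜))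
  | inf_grassmannian (x : X) (i : I) (j : ℕ) (h : 0 < j) : Rel B x (grassmannian i j) zero
  -- the `sl₂` relations
  | sl2_EF (x : X) (i : I) :
      Rel B x (one [E i, F i])
        ((((sideEF i i).comp (sideFE i i)).smul (B.β i x : 𝕜)).add
          ((sumEF i (D.h i x - 1)).smul (-(B.β i x : 𝕜))))
  | sl2_FE (x : X) (i : I) :
      Rel B x (one [F i, E i])
        ((((sideFE i i).comp (sideEF i i)).smul (B.β i x : 𝕜)).add
          ((sumFE i (-D.h i x - 1)).smul (-(B.β i x : 𝕜))))

/-- `HasDegree D x f d`: the diagrams in `f` are homogeneous of degree `d` when the rightmost region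
has weight `x`. -/
inductive HasDegree (D : CartanDatum I X) :
    X → ∀ {u v : Word I}, Term 𝕜 I u v → ℤ → Prop
  | eqHom (x : X) {u v : Word I} (h : u = v) : HasDegree D x (eqHom h) 0
  | comp (x : X) {u v w : Word I} {f : Term 𝕜 I u v} {g : Term 𝕜 I v w} {d e : ℤ} :
      HasDegree D x f d → HasDegree D x g e → HasDegree D x (f.comp g) (d + e)
  | wl (x : X) (a : Word I) {u v : Word I} {f : Term 𝕜 I u v} {d : ℤ} :
      HasDegree D x f d → HasDegree D x (f.wl a) d
  | wr (x : X) {u v : Word I} {f : Term 𝕜 I u v} (b : Word I) {d : ℤ} :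
      HasDegree D (x + D.wt b) f d → HasDegree D x (f.wr b) d
  | zero (x : X) {u v : Word I} (d : ℤ) : HasDegree D x (zero : Term 𝕜 I u v) d
  | add (x : X) {u v : Word I} {f g : Term 𝕜 I u v} {d : ℤ} :
      HasDegree D x f d → HasDegree D x g d → HasDegree D x (f.add g) d
  | smul (x : X) {u v : Word I} (c : 𝕜) {f : Term 𝕜 I u v} {d : ℤ} :
      HasDegree D x f d → HasDegree D x (f.smul c) d
  | dot (x : X) (i : I) : HasDegree D x (dot i) (D.a i i)
  | cross (x : X) (i j : I) : HasDegree D x (cross i j) (-D.a i j)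
  | cupFE (x : X) (i : I) : HasDegree D x (cupFE i) (1 + D.h i x)
  | cupEF (x : X) (i : I) : HasDegree D x (cupEF i) (1 - D.h i x)
  | capFE (x : X) (i : I) : HasDegree D x (capFE i) (1 + D.h i x)
  | capEF (x : X) (i : I) : HasDegree D x (capEF i) (1 - D.h i x)
  | cwStar (x : X) (i : I) (j : ℕ) : HasDegree D x (cwStar i j) (2 * j)
  | ccwStar (x : X) (i : I) (j : ℕ) : HasDegree D x (ccwStar i j) (2 * j)

/-- The space of 2-morphisms of all degrees from `u` to `v`, as 1-morphisms with source `x`. -/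
def Hom2 (B : BubbleParams Q) (x : X) (u v : Word I) : Type (max u₁ u₂) :=
  Quot (Rel B x (u := u) (v := v))

namespace Hom2

variable {B : BubbleParams Q} {x y : X} {u v w z : Word I}

/-- The 2-morphism represented by a linear combination of diagrams. -/
def mk (B : BubbleParams Q) (x : X) (f : Term 𝕜 I u v) : Hom2 B x u v := Quot.mk _ f

theorem sound {f g : Term 𝕜 I u v} (h : Rel B x f g) : mk B x f = mk B x g := Quot.sound h

theorem ind {p : Hom2 B x u v → Prop} (h : ∀ f, p (mk B x f)) (f : Hom2 B x u v) : p f :=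
  Quot.ind h f

instance : Add (Hom2 B x u v) where
  add := Quot.map₂ Term.add (fun f _ _ h => Rel.add_right x f h) (fun _ _ g h => Rel.add_left x g h)

instance : Zero (Hom2 B x u v) where
  zero := mk B x Term.zero

instance : SMul 𝕜 (Hom2 B x u v) where
  smul c := Quot.map (Term.smul c) (fun _ _ h => Rel.smul_congr x c h)

instance : Neg (Hom2 B x u v) where
  neg f := (-1 : 𝕜) • f

theorem mk_add (f g : Term 𝕜 I u v) : mk B x (f.add g) = mk B x f + mk B x g := rfl

theorem mk_smul (c : 𝕜) (f : Term 𝕜 I u v) : mk B x (f.smul c) = c • mk B x f := rfl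

theorem mk_zero : mk B x (Term.zero : Term 𝕜 I u v) = 0 := rfl

protected theorem add_comm (f g : Hom2 B x u v) : f + g = g + f := by
  induction f using ind with | _ f
  induction g using ind with | _ g
  exact sound (Rel.add_comm x f g)

protected theorem zero_add (f : Hom2 B x u v) : 0 + f = f := by
  induction f using ind with | _ f
  exact sound (Rel.zero_add x f)

protected theorem add_smul (c d : 𝕜) (f : Hom2 B x u v) : (c + d) • f = c • f + d • f := by
  induction f using ind with | _ f
  exact sound (Rel.add_smul x c d f)

protected theorem one_smul (f : Hom2 B x u v) : (1 : 𝕜) • f = f := by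
  induction f using ind with | _ f
  exact sound (Rel.one_smul x f)

protected theorem zero_smul (f : Hom2 B x u v) : (0 : 𝕜) • f = 0 := by
  induction f using ind with | _ f
  exact sound (Rel.zero_smul x f)

instance : AddCommGroup (Hom2 B x u v) where
  add_assoc f g h := by
    induction f using ind with | _ f
    induction g using ind with | _ g
    induction h using ind with | _ h
    exact sound (Rel.add_assoc x f g h)
  zero_add := Hom2.zero_add
  add_zero f := by rw [Hom2.add_comm, Hom2.zero_add]
  add_comm := Hom2.add_comm
  nsmul := nsmulRec
  zsmul := zsmulRec
  neg_add_cancel f := by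
    change (-1 : 𝕜) • f + f = 0
    nth_rw 2 [← Hom2.one_smul f]
    rw [← Hom2.add_smul, neg_add_cancel, Hom2.zero_smul]

instance : Module 𝕜 (Hom2 B x u v) where
  one_smul := Hom2.one_smul
  mul_smul c d f := by
    induction f using ind with | _ f
    exact sound (Rel.mul_smul x c d f)
  smul_zero c := by
    rw [← Hom2.zero_smul (0 : Hom2 B x u v)]
    change c • (0 : 𝕜) • mk B x Term.zero = _
    rw [← mk_smul, ← mk_smul, ← sound (Rel.mul_smul x c 0 Term.zero), mul_zero]
    rfl
  smul_add c f g := by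
    induction f using ind with | _ f
    induction g using ind with | _ g
    exact sound (Rel.smul_add x c f g)
  add_smul := Hom2.add_smul
  zero_smul := Hom2.zero_smul

/-- Vertical composition. -/
def comp (f : Hom2 B x u v) (g : Hom2 B x v w) : Hom2 B x u w :=
  Quot.map₂ Term.comp (fun f _ _ h => Rel.comp_right x f h) (fun _ _ g h => Rel.comp_left x g h)
    f g

/-- Adding vertical strands on the left. -/
def wl (a : Word I) (f : Hom2 B x u v) : Hom2 B x (a ++ u) (a ++ v) :=
  Quot.map (Term.wl a) (fun _ _ h => Rel.wl_congr x a h) f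

/-- Adding vertical strands on the right. -/
def wr (b : Word I) (h : x + D.wt b = y) (f : Hom2 B y u v) : Hom2 B x (u ++ b) (v ++ b) :=
  Quot.map (fun f => Term.wr f b) (fun _ _ r => Rel.wr_congr x b (h ▸ r)) f

/-- The homogeneous 2-morphisms of degree `d`. -/
def degPart (B : BubbleParams Q) (x : X) (u v : Word I) (d : ℤ) : Submodule 𝕜 (Hom2 B x u v) where
  carrier := {f | ∃ t, HasDegree D x t d ∧ mk B x t = f}
  add_mem' := by
    rintro _ _ ⟨s, hs, rfl⟩ ⟨t, ht, rfl⟩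
    exact ⟨s.add t, hs.add x ht, rfl⟩
  zero_mem' := ⟨Term.zero, HasDegree.zero x d, rfl⟩
  smul_mem' := by
    rintro c _ ⟨t, ht, rfl⟩
    exact ⟨t.smul c, ht.smul x c, rfl⟩

theorem mk_mem {f : Term 𝕜 I u v} {d e : ℤ} (h : HasDegree D x f d) (hd : d = e) :
    mk B x f ∈ degPart B x u v e := ⟨f, hd ▸ h, rfl⟩

theorem comp_mem {f : Hom2 B x u v} {g : Hom2 B x v w} {d e k : ℤ} (hf : f ∈ degPart B x u v d)
    (hg : g ∈ degPart B x v w e) (hk : d + e = k) : f.comp g ∈ degPart B x u w k := by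
  obtain ⟨s, hs, rfl⟩ := hf
  obtain ⟨t, ht, rfl⟩ := hg
  exact ⟨s.comp t, hk ▸ hs.comp x ht, rfl⟩

theorem wl_mem (a : Word I) {f : Hom2 B x u v} {d e : ℤ} (hf : f ∈ degPart B x u v d)
    (h : d = e) : f.wl a ∈ degPart B x (a ++ u) (a ++ v) e := by
  obtain ⟨s, hs, rfl⟩ := hf
  exact ⟨s.wl a, h ▸ hs.wl x a, rfl⟩

theorem wr_mem (b : Word I) (hy : x + D.wt b = y) {f : Hom2 B y u v} {d e : ℤ}
    (hf : f ∈ degPart B y u v d) (h : d = e) :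
    f.wr b hy ∈ degPart B x (u ++ b) (v ++ b) e := by
  obtain ⟨s, hs, rfl⟩ := hf
  subst hy
  exact ⟨s.wr b, h ▸ hs.wr x b, rfl⟩

end Hom2

/-- The objects of the 2-category of shifted words: weights. -/
structure Core (B : BubbleParams Q) where
  wt : X

/-- A 1-morphism `x → y` without direct sums: a word from `x` to `y` with a grading shift. -/
structure ShiftedWord (B : BubbleParams Q) (x y : Core B) where
  word : Word I
  shift : ℤ
  target : x.wt + D.wt word = y.wt

namespace Core

variable {B : BubbleParams Q} {x y z : Core B}

/-- The 2-morphisms `u⟨s⟩ → v⟨t⟩`: the 2-morphisms `u → v` of degree `t - s`. -/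
abbrev Hom (f g : ShiftedWord B x y) : Type (max u₁ u₂) :=
  Hom2.degPart B x.wt f.word g.word (g.shift - f.shift)

instance : Category (ShiftedWord B x y) where
  Hom f g := Core.Hom f g
  id f := ⟨Hom2.mk B x.wt (Term.one f.word), Hom2.mk_mem (.eqHom _ rfl) (by simp)⟩
  comp a b := ⟨a.1.comp b.1, Hom2.comp_mem a.2 b.2 (by ring)⟩
  id_comp := by
    rintro f g ⟨a, ha⟩
    apply Subtype.ext
    induction a using Hom2.ind with | _ a
    exact Hom2.sound (Rel.id_comp x.wt a)
  comp_id := by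
    rintro f g ⟨a, ha⟩
    apply Subtype.ext
    induction a using Hom2.ind with | _ a
    exact Hom2.sound (Rel.comp_id x.wt a)
  assoc := by
    rintro f g h k ⟨a, ha⟩ ⟨b, hb⟩ ⟨c, hc⟩
    apply Subtype.ext
    induction a using Hom2.ind with | _ a
    induction b using Hom2.ind with | _ b
    induction c using Hom2.ind with | _ c
    exact Hom2.sound (Rel.assoc x.wt a b c)

instance (f g : ShiftedWord B x y) : AddCommGroup (f ⟶ g) :=
  inferInstanceAs (AddCommGroup (Hom2.degPart B x.wt f.word g.word (g.shift - f.shift)))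

instance (f g : ShiftedWord B x y) : Module 𝕜 (f ⟶ g) :=
  inferInstanceAs (Module 𝕜 (Hom2.degPart B x.wt f.word g.word (g.shift - f.shift)))

instance : Preadditive (ShiftedWord B x y) where
  add_comp := by
    rintro f g h ⟨a, ha⟩ ⟨b, hb⟩ ⟨c, hc⟩
    apply Subtype.ext
    induction a using Hom2.ind with | _ a
    induction b using Hom2.ind with | _ b
    induction c using Hom2.ind with | _ c
    exact Hom2.sound (Rel.add_comp x.wt a b c)
  comp_add := by
    rintro f g h ⟨a, ha⟩ ⟨b, hb⟩ ⟨c, hc⟩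
    apply Subtype.ext
    induction a using Hom2.ind with | _ a
    induction b using Hom2.ind with | _ b
    induction c using Hom2.ind with | _ c
    exact Hom2.sound (Rel.comp_add x.wt a b c)

instance : Linear 𝕜 (ShiftedWord B x y) where
  smul_comp := by
    rintro f g h c ⟨a, ha⟩ ⟨b, hb⟩
    apply Subtype.ext
    induction a using Hom2.ind with | _ a
    induction b using Hom2.ind with | _ b
    exact Hom2.sound (Rel.smul_comp x.wt c a b)
  comp_smul := by
    rintro f g h ⟨a, ha⟩ c ⟨b, hb⟩
    apply Subtype.ext
    induction a using Hom2.ind with | _ a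
    induction b using Hom2.ind with | _ b
    exact Hom2.sound (Rel.comp_smul x.wt c a b)

theorem eqHom_comp {u v w : Word I} (t : X) (h : u = v) (h' : v = w) :
    (Hom2.mk B t (Term.eqHom h)).comp (Hom2.mk B t (Term.eqHom h')) =
      Hom2.mk B t (Term.eqHom (h.trans h')) := by
  subst h
  exact Hom2.sound (Rel.id_comp t _)

theorem wl_eqHom (t : X) (a : Word I) {u v : Word I} (h : u = v) :
    (Hom2.mk B t (Term.eqHom h)).wl a = Hom2.mk B t (Term.eqHom (congrArg (a ++ ·) h)) := by
  subst h
  exact Hom2.sound (Rel.wl_id t a u)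

theorem wr_eqHom {t t' : X} (b : Word I) (ht : t + D.wt b = t') {u v : Word I} (h : u = v) :
    (Hom2.mk B t' (Term.eqHom h)).wr b ht = Hom2.mk B t (Term.eqHom (congrArg (· ++ b) h)) := by
  subst h
  exact Hom2.sound (Rel.id_wr t u b)

/-- The identity between equal words with equal shifts. -/
def eqIso (f g : ShiftedWord B x y) (hw : f.word = g.word) (hs : f.shift = g.shift) : f ≅ g where
  hom := ⟨Hom2.mk B x.wt (Term.eqHom hw), Hom2.mk_mem (.eqHom _ hw) (by simp [hs])⟩
  inv := ⟨Hom2.mk B x.wt (Term.eqHom hw.symm), Hom2.mk_mem (.eqHom _ hw.symm) (by simp [hs])⟩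
  hom_inv_id := Subtype.ext (eqHom_comp x.wt hw hw.symm)
  inv_hom_id := Subtype.ext (eqHom_comp x.wt hw.symm hw)

instance : CategoryStruct (Core B) where
  Hom x y := ShiftedWord B x y
  id x := ⟨[], 0, by simp [CartanDatum.wt]⟩
  comp f g := ⟨g.word ++ f.word, g.shift + f.shift, by
    rw [CartanDatum.wt_append, ← g.target, ← f.target]; abel⟩

/-- The 2-category of shifted words. As diagrams are read from right to left, the composite
`f ≫ g` is the word of `g` followed by the word of `f`. -/
instance : Bicategory (Core B) where
  homCategory x y := inferInstanceAs (Category (ShiftedWord B x y))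
  whiskerLeft {x y z} f {g h} η :=
    ⟨Hom2.wr f.word f.target η.1, Hom2.wr_mem _ f.target η.2 (by
      change _ = (h.shift + f.shift) - (g.shift + f.shift); ring)⟩
  whiskerRight {x y z f g} η h :=
    ⟨Hom2.wl h.word η.1, Hom2.wl_mem _ η.2 (by
      change _ = (h.shift + g.shift) - (h.shift + f.shift); ring)⟩
  associator f g h := eqIso _ _ (List.append_assoc _ _ _).symm (add_assoc _ _ _).symm
  leftUnitor f := eqIso _ _ (List.append_nil _) (add_zero _)
  rightUnitor f := eqIso _ _ rfl (zero_add _)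
  whiskerLeft_id {x y z} f g := Subtype.ext (Hom2.sound (Rel.id_wr x.wt g.word f.word))
  whiskerLeft_comp := by
    rintro x y z f g h i ⟨a, ha⟩ ⟨b, hb⟩
    apply Subtype.ext
    induction a using Hom2.ind with | _ a
    induction b using Hom2.ind with | _ b
    exact Hom2.sound (Rel.comp_wr x.wt a b f.word)
  id_whiskerLeft := by
    rintro x y f g ⟨a, ha⟩
    apply Subtype.ext
    induction a using Hom2.ind with | _ a
    exact Hom2.sound (Rel.wr_nil x.wt a)
  comp_whiskerLeft := by
    rintro x y z t f g h h' ⟨a, ha⟩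
    apply Subtype.ext
    induction a using Hom2.ind with | _ a
    exact Hom2.sound (Rel.wr_append x.wt a g.word f.word)
  id_whiskerRight {x y z} f g := Subtype.ext (Hom2.sound (Rel.wl_id x.wt g.word f.word))
  comp_whiskerRight := by
    rintro x y z f g h ⟨a, ha⟩ ⟨b, hb⟩ i
    apply Subtype.ext
    induction a using Hom2.ind with | _ a
    induction b using Hom2.ind with | _ b
    exact Hom2.sound (Rel.wl_comp x.wt i.word a b)
  whiskerRight_id := by
    rintro x y f g ⟨a, ha⟩
    apply Subtype.ext
    induction a using Hom2.ind with | _ a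
    refine (Hom2.sound (Rel.wl_nil x.wt a)).trans ?_
    exact ((Hom2.sound (Rel.id_comp x.wt _)).trans (Hom2.sound (Rel.comp_id x.wt a))).symm
  whiskerRight_comp := by
    rintro x y z t f f' ⟨a, ha⟩ g h
    apply Subtype.ext
    induction a using Hom2.ind with | _ a
    exact Hom2.sound (Rel.wl_append x.wt h.word g.word a)
  whisker_assoc := by
    rintro x y z t f g g' ⟨a, ha⟩ h
    apply Subtype.ext
    induction a using Hom2.ind with | _ a
    exact Hom2.sound (Rel.wl_wr x.wt h.word a f.word)
  whisker_exchange := by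
    rintro x y z f g h i ⟨a, ha⟩ ⟨b, hb⟩
    apply Subtype.ext
    induction a using Hom2.ind with | _ a
    induction b using Hom2.ind with | _ b
    exact Hom2.sound (Rel.exchange x.wt b a
      (add_left_cancel (f.target.trans g.target.symm)))
  pentagon {x y z t r} f g h i := by
    apply Subtype.ext
    change Hom2.comp (Hom2.wl _ (Hom2.mk B x.wt (Term.eqHom _)))
      (Hom2.comp (Hom2.mk B x.wt (Term.eqHom _)) (Hom2.wr _ f.target (Hom2.mk B y.wt (Term.eqHom _)))) =
      Hom2.comp (Hom2.mk B x.wt (Term.eqHom _)) (Hom2.mk B x.wt (Term.eqHom _))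
    rw [wl_eqHom, wr_eqHom, eqHom_comp, eqHom_comp, eqHom_comp]
  triangle {x y z} f g := by
    apply Subtype.ext
    change Hom2.comp (Hom2.mk B x.wt (Term.eqHom _))
      (Hom2.wr _ f.target (Hom2.mk B y.wt (Term.eqHom _))) = Hom2.wl _ (Hom2.mk B x.wt (Term.eqHom _))
    rw [wl_eqHom, wr_eqHom, eqHom_comp]

end Core
end Relations

section AdditiveClosure

open Bicategory

/-- A bicategory with additive hom groups of 2-morphisms and biadditive horizontal composition. -/
class PreadditiveBicategory (C : Type*) [Bicategory C] where
  preadditive : ∀ a b : C, Preadditive (a ⟶ b) := by infer_instance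
  whiskerLeft_add : ∀ {a b c : C} (f : a ⟶ b) {g h : b ⟶ c} (η θ : g ⟶ h),
    f ◁ (η + θ) = f ◁ η + f ◁ θ
  add_whiskerRight : ∀ {a b c : C} {f g : a ⟶ b} (η θ : f ⟶ g) (h : b ⟶ c),
    (η + θ) ▷ h = η ▷ h + θ ▷ h

attribute [instance, reducible] PreadditiveBicategory.preadditive

/-- A bicategory with `𝕜`-vector spaces of 2-morphisms and bilinear compositions. -/
class LinearBicategory (𝕜 : Type u₁) [Field 𝕜] (C : Type*) [Bicategory C]
    [PreadditiveBicategory C] where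
  linear : ∀ a b : C, Linear 𝕜 (a ⟶ b) := by infer_instance
  whiskerLeft_smul : ∀ {a b c : C} (r : 𝕜) (f : a ⟶ b) {g h : b ⟶ c} (η : g ⟶ h),
    f ◁ (r • η) = r • (f ◁ η)
  smul_whiskerRight : ∀ {a b c : C} (r : 𝕜) {f g : a ⟶ b} (η : f ⟶ g) (h : b ⟶ c),
    (r • η) ▷ h = r • (η ▷ h)

attribute [instance, reducible] LinearBicategory.linear

namespace MatAux

variable {C : Type*} [Category C] [Preadditive C]

instance {𝕜 : Type*} [Field 𝕜] [Linear 𝕜 C] (M N : Mat_ C) : Module 𝕜 (M ⟶ N) :=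
  inferInstanceAs (Module 𝕜 (∀ i j, M.X i ⟶ N.X j))

instance {𝕜 : Type*} [Field 𝕜] [Linear 𝕜 C] : Linear 𝕜 (Mat_ C) where
  smul_comp M N K r f g := by
    ext i k
    change ∑ j, (r • f i j) ≫ g j k = r • ∑ j, f i j ≫ g j k
    simp [Finset.smul_sum]
  comp_smul M N K f r g := by
    ext i k
    change ∑ j, f i j ≫ (r • g j k) = r • ∑ j, f i j ≫ g j k
    simp [Finset.smul_sum]

/-- The isomorphism of formal direct sums given by a bijection of the index sets and isomorphisms
of the corresponding summands. -/
def reindexHom {M N : Mat_ C} (e : M.ι ≃ N.ι) (φ : ∀ i, M.X i ⟶ N.X (e i)) : M ⟶ N :=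
  fun i j => φ i ≫ (𝟙 N : Mat_.Hom N N) (e i) j

theorem reindexHom_comp {M N K : Mat_ C} (e : M.ι ≃ N.ι) (φ : ∀ i, M.X i ⟶ N.X (e i)) (g : N ⟶ K)
    (i k) : (reindexHom e φ ≫ g) i k = φ i ≫ g (e i) k := by
  have : (𝟙 N ≫ g) (e i) k = g (e i) k := by rw [Category.id_comp]
  rw [Mat_.comp_apply] at this ⊢
  rw [← this, Preadditive.comp_sum]
  exact Finset.sum_congr rfl fun j _ => Category.assoc _ _ _

theorem reindexHom_apply {M N : Mat_ C} (e : M.ι ≃ N.ι) (φ : ∀ i, M.X i ⟶ N.X (e i)) (i) :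
    reindexHom e φ i (e i) = φ i := by simp [reindexHom]

theorem reindexHom_apply_ne {M N : Mat_ C} (e : M.ι ≃ N.ι) (φ : ∀ i, M.X i ⟶ N.X (e i)) (i j)
    (h : e i ≠ j) : reindexHom e φ i j = 0 := by simp [reindexHom, h]

theorem comp_reindexHom {M N K : Mat_ C} (e : M.ι ≃ N.ι) (φ : ∀ i, M.X i ⟶ N.X (e i)) (g : K ⟶ M)
    (k i) : (g ≫ reindexHom e φ) k (e i) = g k i ≫ φ i := by
  rw [Mat_.comp_apply, Finset.sum_eq_single i]
  · rw [reindexHom_apply]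
  · intro j _ h
    rw [reindexHom_apply_ne e φ j (e i) (fun h' => h (e.injective h'))]
    simp
  · simp

theorem reindexHom_comp_reindexHom {M N K : Mat_ C} (e : M.ι ≃ N.ι) (φ : ∀ i, M.X i ⟶ N.X (e i))
    (e' : N.ι ≃ K.ι) (ψ : ∀ i, N.X i ⟶ K.X (e' i)) :
    reindexHom e φ ≫ reindexHom e' ψ =
      reindexHom (e.trans e') fun i => φ i ≫ ψ (e i) := by
  ext i k
  refine (reindexHom_comp _ _ _ _ _).trans ?_
  exact (Category.assoc _ _ _).symm

theorem reindexHom_congr {M N : Mat_ C} {e : M.ι ≃ N.ι} {φ ψ : ∀ i, M.X i ⟶ N.X (e i)}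
    (h : ∀ i, φ i = ψ i) : reindexHom e φ = reindexHom e ψ := by
  rw [funext h]

theorem hom_ext_equiv {M N K : Mat_ C} (e : M.ι ≃ N.ι) {f g : K ⟶ N}
    (h : ∀ k i, f k (e i) = g k (e i)) : f = g := by
  ext k j
  obtain ⟨i, rfl⟩ := e.surjective j
  exact h k i

/-- The inverse of `reindexHom`. -/
def reindexInv {M N : Mat_ C} (e : M.ι ≃ N.ι) (φ : ∀ i, N.X (e i) ⟶ M.X i) : N ⟶ M :=
  fun j i => (𝟙 N : Mat_.Hom N N) j (e i) ≫ φ i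

/-- `reindexHom` as an isomorphism. -/
def reindex {M N : Mat_ C} (e : M.ι ≃ N.ι) (φ : ∀ i, M.X i ≅ N.X (e i)) : M ≅ N where
  hom := reindexHom e fun i => (φ i).hom
  inv := reindexInv e fun i => (φ i).inv
  hom_inv_id := by
    ext i k
    refine (reindexHom_comp _ _ _ _ _).trans ?_
    by_cases h : i = k
    · subst h; simp [reindexInv]
    · rw [Mat_.id_apply_of_ne _ _ _ h, reindexInv,
        Mat_.id_apply_of_ne _ _ _ (fun h' => h (e.injective h'))]
      simp
  inv_hom_id := by
    refine hom_ext_equiv e fun j i => ?_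
    refine (comp_reindexHom _ _ _ _ _).trans ?_
    simp [reindexInv]

end MatAux

open MatAux

/-- The additive closure of a linear bicategory: the same objects, formal finite direct sums of
1-morphisms, and matrices of 2-morphisms. -/
structure AddClosure (C : Type*) where
  obj : C

namespace AddClosure

variable {C : Type*} [Bicategory C] [PreadditiveBicategory C]

theorem whiskerLeft_zero {a b c : C} (f : a ⟶ b) (g h : b ⟶ c) : f ◁ (0 : g ⟶ h) = 0 := by
  have := PreadditiveBicategory.whiskerLeft_add f (0 : g ⟶ h) 0
  simpa using this

theorem zero_whiskerRight {a b c : C} (f g : a ⟶ b) (h : b ⟶ c) : (0 : f ⟶ g) ▷ h = 0 := by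
  have := PreadditiveBicategory.add_whiskerRight (0 : f ⟶ g) 0 h
  simpa using this

theorem whiskerLeft_sum {ι : Type*} (s : Finset ι) {a b c : C} (f : a ⟶ b) {g h : b ⟶ c}
    (η : ι → (g ⟶ h)) : f ◁ (∑ i ∈ s, η i) = ∑ i ∈ s, f ◁ η i :=
  map_sum (AddMonoidHom.mk' (fun η : g ⟶ h => f ◁ η)
    (PreadditiveBicategory.whiskerLeft_add f)) η s

theorem sum_whiskerRight {ι : Type*} (s : Finset ι) {a b c : C} {f g : a ⟶ b}
    (η : ι → (f ⟶ g)) (h : b ⟶ c) : (∑ i ∈ s, η i) ▷ h = ∑ i ∈ s, η i ▷ h :=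
  map_sum (AddMonoidHom.mk' (fun η : f ⟶ g => η ▷ h)
    (fun η θ => PreadditiveBicategory.add_whiskerRight η θ h)) η s

variable {a b c d k : C}

/-- The composite of formal direct sums of 1-morphisms. -/
abbrev prodObj (M : Mat_ (a ⟶ b)) (K : Mat_ (b ⟶ c)) : Mat_ (a ⟶ c) where
  ι := M.ι × K.ι
  X p := M.X p.1 ≫ K.X p.2

/-- The identity 1-morphism. -/
abbrev unitObj (a : C) : Mat_ (a ⟶ a) where
  ι := PUnit
  X _ := 𝟙 a

/-- Horizontal composition of matrices. -/
def hcomp {M N : Mat_ (a ⟶ b)} {K L : Mat_ (b ⟶ c)} (f : M ⟶ N) (g : K ⟶ L) :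
    prodObj M K ⟶ prodObj N L :=
  fun p q => f p.1 q.1 ▷ K.X p.2 ≫ N.X q.1 ◁ g p.2 q.2

theorem hcomp_comp {M N P : Mat_ (a ⟶ b)} {K L R : Mat_ (b ⟶ c)}
    (f : M ⟶ N) (f' : N ⟶ P) (g : K ⟶ L) (g' : L ⟶ R) :
    hcomp (f ≫ f') (g ≫ g') = hcomp f g ≫ hcomp f' g' := by
  ext p q
  refine Eq.trans ?_ (Fintype.sum_prod_type _).symm
  change (f ≫ f') p.1 q.1 ▷ K.X p.2 ≫ P.X q.1 ◁ (g ≫ g') p.2 q.2 =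
    ∑ i, ∑ j, (f p.1 i ▷ K.X p.2 ≫ N.X i ◁ g p.2 j) ≫ (f' i q.1 ▷ L.X j ≫ P.X q.1 ◁ g' j q.2)
  simp only [Mat_.comp_apply, sum_whiskerRight, whiskerLeft_sum, Preadditive.sum_comp,
    Preadditive.comp_sum, comp_whiskerRight, whiskerLeft_comp, Category.assoc]
  rw [Finset.sum_comm]
  refine Finset.sum_congr rfl fun j _ => Finset.sum_congr rfl fun k _ => ?_
  rw [whisker_exchange_assoc]

theorem hcomp_id (M : Mat_ (a ⟶ b)) (K : Mat_ (b ⟶ c)) :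
    hcomp (𝟙 M) (𝟙 K) = 𝟙 (prodObj M K) := by
  ext p q
  change (𝟙 M : Mat_.Hom M M) p.1 q.1 ▷ K.X p.2 ≫ M.X q.1 ◁ (𝟙 K : Mat_.Hom K K) p.2 q.2 = _
  by_cases hpq : p = q
  · subst hpq
    refine Eq.trans ?_ (Mat_.id_apply_self (prodObj M K) p).symm
    rw [Mat_.id_apply_self, Mat_.id_apply_self, id_whiskerRight, whiskerLeft_id, Category.comp_id]
  · refine Eq.trans ?_ (Mat_.id_apply_of_ne (prodObj M K) p q hpq).symm
    by_cases h : p.1 = q.1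
    · have h' : p.2 ≠ q.2 := fun h' => hpq (Prod.ext h h')
      rw [Mat_.id_apply_of_ne K _ _ h', whiskerLeft_zero, Limits.comp_zero]
    · rw [Mat_.id_apply_of_ne M _ _ h, zero_whiskerRight, Limits.zero_comp]

theorem hcomp_id_comp (M : Mat_ (a ⟶ b)) {K L R : Mat_ (b ⟶ c)} (g : K ⟶ L) (g' : L ⟶ R) :
    hcomp (𝟙 M) (g ≫ g') = hcomp (𝟙 M) g ≫ hcomp (𝟙 M) g' := by
  rw [← hcomp_comp, Category.comp_id]

theorem hcomp_comp_id {M N P : Mat_ (a ⟶ b)} (f : M ⟶ N) (f' : N ⟶ P) (K : Mat_ (b ⟶ c)) :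
    hcomp (f ≫ f') (𝟙 K) = hcomp f (𝟙 K) ≫ hcomp f' (𝟙 K) := by
  rw [← hcomp_comp, Category.comp_id]

theorem hcomp_exchange {M N : Mat_ (a ⟶ b)} {K L : Mat_ (b ⟶ c)} (f : M ⟶ N) (g : K ⟶ L) :
    hcomp (𝟙 M) g ≫ hcomp f (𝟙 L) = hcomp f (𝟙 K) ≫ hcomp (𝟙 N) g := by
  rw [← hcomp_comp, ← hcomp_comp]
  simp only [Category.comp_id, Category.id_comp]

theorem reindexHom_hcomp_id {M N : Mat_ (a ⟶ b)} (e : M.ι ≃ N.ι) (φ : ∀ i, M.X i ⟶ N.X (e i))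
    (K : Mat_ (b ⟶ c)) :
    hcomp (reindexHom e φ) (𝟙 K) =
      reindexHom (M := prodObj M K) (N := prodObj N K) (e.prodCongr (Equiv.refl _))
        fun p => φ p.1 ▷ K.X p.2 := by
  ext p q
  change _ = φ p.1 ▷ K.X p.2 ≫ (𝟙 (prodObj N K) : Mat_.Hom _ _) (e p.1, p.2) q
  rw [← hcomp_id]
  change (φ p.1 ≫ (𝟙 N : Mat_.Hom N N) (e p.1) q.1) ▷ K.X p.2 ≫
      N.X q.1 ◁ (𝟙 K : Mat_.Hom K K) p.2 q.2 =
    φ p.1 ▷ K.X p.2 ≫ ((𝟙 N : Mat_.Hom N N) (e p.1) q.1 ▷ K.X p.2 ≫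
      N.X q.1 ◁ (𝟙 K : Mat_.Hom K K) p.2 q.2)
  rw [comp_whiskerRight, Category.assoc]

theorem id_hcomp_reindexHom {M N : Mat_ (b ⟶ c)} (e : M.ι ≃ N.ι) (φ : ∀ i, M.X i ⟶ N.X (e i))
    (K : Mat_ (a ⟶ b)) :
    hcomp (𝟙 K) (reindexHom e φ) =
      reindexHom (M := prodObj K M) (N := prodObj K N) ((Equiv.refl _).prodCongr e)
        fun p => K.X p.1 ◁ φ p.2 := by
  ext p q
  change _ = K.X p.1 ◁ φ p.2 ≫ (𝟙 (prodObj K N) : Mat_.Hom _ _) (p.1, e p.2) q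
  rw [← hcomp_id]
  change (𝟙 K : Mat_.Hom K K) p.1 q.1 ▷ M.X p.2 ≫
      K.X q.1 ◁ (φ p.2 ≫ (𝟙 N : Mat_.Hom N N) (e p.2) q.2) =
    K.X p.1 ◁ φ p.2 ≫ ((𝟙 K : Mat_.Hom K K) p.1 q.1 ▷ N.X (e p.2) ≫
      K.X q.1 ◁ (𝟙 N : Mat_.Hom N N) (e p.2) q.2)
  rw [whiskerLeft_comp, whisker_exchange_assoc]

/-- The associator. -/
def assocIso (M : Mat_ (a ⟶ b)) (N : Mat_ (b ⟶ c)) (K : Mat_ (c ⟶ d)) :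
    prodObj (prodObj M N) K ≅ prodObj M (prodObj N K) :=
  reindex (M := prodObj (prodObj M N) K) (N := prodObj M (prodObj N K)) (Equiv.prodAssoc _ _ _)
    fun p => α_ (M.X p.1.1) (N.X p.1.2) (K.X p.2)

/-- The left unitor. -/
def leftUnitIso (M : Mat_ (a ⟶ b)) : prodObj (unitObj a) M ≅ M :=
  reindex (M := prodObj (unitObj a) M) (Equiv.punitProd _) fun p => λ_ (M.X p.2)

/-- The right unitor. -/
def rightUnitIso (M : Mat_ (a ⟶ b)) : prodObj M (unitObj b) ≅ M :=
  reindex (M := prodObj M (unitObj b)) (Equiv.prodPUnit _) fun p => ρ_ (M.X p.1)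

theorem assoc_naturality {M M' : Mat_ (a ⟶ b)} {N N' : Mat_ (b ⟶ c)}
    {K K' : Mat_ (c ⟶ d)} (f : M ⟶ M') (g : N ⟶ N') (h : K ⟶ K') :
    hcomp (hcomp f g) h ≫ (assocIso M' N' K').hom =
      (assocIso M N K).hom ≫ hcomp f (hcomp g h) := by
  refine hom_ext_equiv (M := prodObj (prodObj M' N') K') (Equiv.prodAssoc _ _ _) fun p q => ?_
  refine (comp_reindexHom _ _ _ _ _).trans (Eq.trans ?_ (reindexHom_comp _ _ _ _ _).symm)
  obtain ⟨⟨i, j⟩, k⟩ := p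
  obtain ⟨⟨i', j'⟩, k'⟩ := q
  change ((f i i' ▷ N.X j ≫ M'.X i' ◁ g j j') ▷ K.X k ≫ (M'.X i' ≫ N'.X j') ◁ h k k') ≫
      (α_ (M'.X i') (N'.X j') (K'.X k')).hom =
    (α_ (M.X i) (N.X j) (K.X k)).hom ≫ f i i' ▷ (N.X j ≫ K.X k) ≫
      M'.X i' ◁ (g j j' ▷ K.X k ≫ N'.X j' ◁ h k k')
  simp

theorem leftUnit_naturality {M M' : Mat_ (a ⟶ b)} (f : M ⟶ M') :
    hcomp (𝟙 (unitObj a)) f ≫ (leftUnitIso M').hom = (leftUnitIso M).hom ≫ f := by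
  refine hom_ext_equiv (M := prodObj (unitObj a) M') (Equiv.punitProd _) fun p q => ?_
  refine (comp_reindexHom _ _ _ _ _).trans (Eq.trans ?_ (reindexHom_comp _ _ _ _ _).symm)
  obtain ⟨⟨⟩, k⟩ := p
  obtain ⟨⟨⟩, k'⟩ := q
  change ((𝟙 (unitObj a) : Mat_.Hom _ _) PUnit.unit PUnit.unit ▷ M.X k ≫ 𝟙 a ◁ f k k') ≫
    (λ_ (M'.X k')).hom = (λ_ (M.X k)).hom ≫ f k k'
  rw [Mat_.id_apply_self]
  simp

theorem rightUnit_naturality {M M' : Mat_ (a ⟶ b)} (f : M ⟶ M') :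
    hcomp f (𝟙 (unitObj b)) ≫ (rightUnitIso M').hom = (rightUnitIso M).hom ≫ f := by
  refine hom_ext_equiv (M := prodObj M' (unitObj b)) (Equiv.prodPUnit _) fun p q => ?_
  refine (comp_reindexHom _ _ _ _ _).trans (Eq.trans ?_ (reindexHom_comp _ _ _ _ _).symm)
  obtain ⟨k, ⟨⟩⟩ := p
  obtain ⟨k', ⟨⟩⟩ := q
  change (f k k' ▷ 𝟙 b ≫ M'.X k' ◁ (𝟙 (unitObj b) : Mat_.Hom _ _) PUnit.unit PUnit.unit) ≫
    (ρ_ (M'.X k')).hom = (ρ_ (M.X k)).hom ≫ f k k'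
  rw [Mat_.id_apply_self]
  simp

theorem pentagon_aux (M : Mat_ (a ⟶ b)) (N : Mat_ (b ⟶ c)) (K : Mat_ (c ⟶ d))
    (L : Mat_ (d ⟶ k)) :
    hcomp (assocIso M N K).hom (𝟙 L) ≫ (assocIso M (prodObj N K) L).hom ≫
        hcomp (𝟙 M) (assocIso N K L).hom =
      (assocIso (prodObj M N) K L).hom ≫ (assocIso M N (prodObj K L)).hom := by
  have h₁ := reindexHom_hcomp_id (M := prodObj (prodObj M N) K) (N := prodObj M (prodObj N K))
    (Equiv.prodAssoc _ _ _) (fun p => (α_ (M.X p.1.1) (N.X p.1.2) (K.X p.2)).hom) L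
  have h₂ := id_hcomp_reindexHom (M := prodObj (prodObj N K) L) (N := prodObj N (prodObj K L))
    (Equiv.prodAssoc _ _ _) (fun p => (α_ (N.X p.1.1) (K.X p.1.2) (L.X p.2)).hom) M
  refine (congrArg₂ (fun s t => s ≫ (assocIso M (prodObj N K) L).hom ≫ t) h₁ h₂).trans ?_
  refine (congrArg (_ ≫ ·) (reindexHom_comp_reindexHom _ _ _ _)).trans ?_
  refine (reindexHom_comp_reindexHom _ _ _ _).trans ?_
  refine Eq.trans ?_ (reindexHom_comp_reindexHom _ _ _ _).symm
  refine reindexHom_congr fun p => ?_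
  exact pentagon (M.X p.1.1.1) (N.X p.1.1.2) (K.X p.1.2) (L.X p.2)

theorem triangle_aux (M : Mat_ (a ⟶ b)) (N : Mat_ (b ⟶ c)) :
    (assocIso M (unitObj b) N).hom ≫ hcomp (𝟙 M) (leftUnitIso N).hom =
      hcomp (rightUnitIso M).hom (𝟙 N) := by
  have h₁ := id_hcomp_reindexHom (M := prodObj (unitObj b) N) (N := N)
    (Equiv.punitProd _) (fun p => (λ_ (N.X p.2)).hom) M
  have h₂ := reindexHom_hcomp_id (M := prodObj M (unitObj b)) (N := M)
    (Equiv.prodPUnit _) (fun p => (ρ_ (M.X p.1)).hom) N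
  refine (congrArg (_ ≫ ·) h₁).trans ?_
  refine (reindexHom_comp_reindexHom _ _ _ _).trans (Eq.trans ?_ h₂.symm)
  refine reindexHom_congr fun p => ?_
  exact triangle (M.X p.1.1) (N.X p.2)

instance : Bicategory (AddClosure C) where
  Hom a b := Mat_ (a.obj ⟶ b.obj)
  id a := unitObj a.obj
  comp M N := prodObj M N
  homCategory a b := inferInstanceAs (Category (Mat_ (a.obj ⟶ b.obj)))
  whiskerLeft f _ _ η := hcomp (𝟙 (f : Mat_ _)) η
  whiskerRight η h := hcomp η (𝟙 (h : Mat_ _))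
  associator f g h := assocIso f g h
  leftUnitor f := leftUnitIso f
  rightUnitor f := rightUnitIso f
  whiskerLeft_id f g := hcomp_id f g
  whiskerLeft_comp f _ _ _ η θ := hcomp_id_comp f η θ
  id_whiskerLeft η := ((Iso.eq_comp_inv _).2 (leftUnit_naturality η)).trans (Category.assoc _ _ _)
  comp_whiskerLeft f g h h' η :=
    ((Iso.eq_comp_inv (assocIso f g h')).2 (Eq.trans (by rw [hcomp_id])
      (assoc_naturality (𝟙 (f : Mat_ _)) (𝟙 (g : Mat_ _)) η))).trans (Category.assoc _ _ _)
  id_whiskerRight f g := hcomp_id f g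
  comp_whiskerRight η θ i := hcomp_comp_id η θ i
  whiskerRight_id η :=
    ((Iso.eq_comp_inv _).2 (rightUnit_naturality η)).trans (Category.assoc _ _ _)
  whiskerRight_comp {_ _ _ _ f f'} η g h :=
    (Iso.eq_inv_comp (assocIso f g h)).2 (Eq.trans (by rw [hcomp_id])
      (assoc_naturality η (𝟙 (g : Mat_ _)) (𝟙 (h : Mat_ _))).symm)
  whisker_assoc f _ _ η h :=
    ((Iso.eq_comp_inv _).2 (assoc_naturality (𝟙 (f : Mat_ _)) η (𝟙 (h : Mat_ _)))).trans
      (Category.assoc _ _ _)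
  whisker_exchange η θ := hcomp_exchange η θ
  pentagon f g h i := pentagon_aux f g h i
  triangle f g := triangle_aux f g

instance : PreadditiveBicategory (AddClosure C) where
  preadditive a b := inferInstanceAs (Preadditive (Mat_ (a.obj ⟶ b.obj)))
  whiskerLeft_add {a b c} f {g h} η θ := by
    refine Mat_.hom_ext (M := prodObj f g) (N := prodObj f h) _ _ fun p q => ?_
    change _ ≫ f.X q.1 ◁ (η p.2 q.2 + θ p.2 q.2) = _
    rw [PreadditiveBicategory.whiskerLeft_add, Preadditive.comp_add]
    rfl
  add_whiskerRight {a b c} {f g} η θ h := by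
    refine Mat_.hom_ext (M := prodObj f h) (N := prodObj g h) _ _ fun p q => ?_
    change (η p.1 q.1 + θ p.1 q.1) ▷ h.X p.2 ≫ _ = _
    rw [PreadditiveBicategory.add_whiskerRight, Preadditive.add_comp]
    rfl

instance {𝕜 : Type u₁} [Field 𝕜] [LinearBicategory 𝕜 C] : LinearBicategory 𝕜 (AddClosure C) where
  linear a b := inferInstanceAs (Linear 𝕜 (Mat_ (a.obj ⟶ b.obj)))
  whiskerLeft_smul {a b c} r f {g h} η := by
    refine Mat_.hom_ext (M := prodObj f g) (N := prodObj f h) _ _ fun p q => ?_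
    change _ ≫ f.X q.1 ◁ (r • η p.2 q.2) = _
    rw [LinearBicategory.whiskerLeft_smul, Linear.comp_smul]
    rfl
  smul_whiskerRight {a b c} r {f g} η h := by
    refine Mat_.hom_ext (M := prodObj f h) (N := prodObj g h) _ _ fun p q => ?_
    change (r • η p.1 q.1) ▷ h.X p.2 ≫ _ = _
    rw [LinearBicategory.smul_whiskerRight, Linear.smul_comp]
    rfl

end AddClosure

end AdditiveClosure

section TheTwoCategory

open Bicategory Letter

variable {𝕜 : Type u₁} [Field 𝕜] {I : Type u₂} {X : Type u₃} [AddCommGroup X]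
  {D : CartanDatum I X} {Q : Scalars 𝕜 D}

instance (B : BubbleParams Q) : PreadditiveBicategory (Core B) where
  preadditive x y := inferInstanceAs (Preadditive (ShiftedWord B x y))
  whiskerLeft_add := by
    rintro x y z f g h ⟨a, ha⟩ ⟨b, hb⟩
    apply Subtype.ext
    induction a using Hom2.ind with | _ a
    induction b using Hom2.ind with | _ b
    exact Hom2.sound (Rel.add_wr x.wt a b f.word)
  add_whiskerRight := by
    rintro x y z f g ⟨a, ha⟩ ⟨b, hb⟩ h
    apply Subtype.ext
    induction a using Hom2.ind with | _ a
    induction b using Hom2.ind with | _ b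
    exact Hom2.sound (Rel.wl_add x.wt h.word a b)

instance (B : BubbleParams Q) : LinearBicategory 𝕜 (Core B) where
  linear x y := inferInstanceAs (Linear 𝕜 (ShiftedWord B x y))
  whiskerLeft_smul := by
    rintro x y z r f g h ⟨a, ha⟩
    apply Subtype.ext
    induction a using Hom2.ind with | _ a
    exact Hom2.sound (Rel.smul_wr x.wt r a f.word)
  smul_whiskerRight := by
    rintro x y z r f g ⟨a, ha⟩ h
    apply Subtype.ext
    induction a using Hom2.ind with | _ a
    exact Hom2.sound (Rel.wl_smul x.wt h.word r a)

/-- The graded additive `𝕜`-linear 2-category `U_{Q,β}`. -/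
abbrev U (B : BubbleParams Q) := AddClosure (Core B)

namespace U

/-- The object `x`. -/
def weight (B : BubbleParams Q) (x : X) : U B := ⟨⟨x⟩⟩

/-- The 1-morphism `w⟨s⟩` from `x` to `y`. -/
def word (B : BubbleParams Q) (x y : X) (w : Word I) (s : ℤ) (h : x + D.wt w = y) :
    weight B x ⟶ weight B y :=
  (Mat_.embedding (ShiftedWord B ⟨x⟩ ⟨y⟩)).obj ⟨w, s, h⟩

/-- The 2-morphism `u → v⟨d⟩` represented by a homogeneous diagram of degree `d`. -/
def diagram (B : BubbleParams Q) (x y : X) {u v : Word I} (hu : x + D.wt u = y)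
    (hv : x + D.wt v = y) (f : Term 𝕜 I u v) {d : ℤ} (hd : HasDegree D x f d) :
    word B x y u 0 hu ⟶ word B x y v d hv :=
  (Mat_.embedding (ShiftedWord B ⟨x⟩ ⟨y⟩)).map
    (X := ⟨u, 0, hu⟩) (Y := ⟨v, d, hv⟩) ⟨Hom2.mk B x f, Hom2.mk_mem hd (sub_zero d).symm⟩

/-- The upward dot `Eᵢ 1ₓ → Eᵢ 1ₓ⟨i · i⟩`. -/
def dot (B : BubbleParams Q) (i : I) (x : X) :=
  diagram B x (x + D.wt [E i]) rfl rfl (Term.dot i) (.dot x i)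

/-- The upward crossing `Eᵢ Eⱼ 1ₓ → Eⱼ Eᵢ 1ₓ⟨-i · j⟩`. -/
def cross (B : BubbleParams Q) (i j : I) (x : X) :=
  diagram B x (x + D.wt [E i, E j]) rfl
    (by simp [CartanDatum.wt, add_comm]) (Term.cross i j) (.cross x i j)

/-- The cup `1ₓ → Fᵢ Eᵢ 1ₓ⟨1 + xᵢ⟩`. -/
def cupFE (B : BubbleParams Q) (i : I) (x : X) :=
  diagram B x x (by simp [CartanDatum.wt]) (by simp [CartanDatum.wt]) (Term.cupFE i) (.cupFE x i)

/-- The cup `1ₓ → Eᵢ Fᵢ 1ₓ⟨1 - xᵢ⟩`. -/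
def cupEF (B : BubbleParams Q) (i : I) (x : X) :=
  diagram B x x (by simp [CartanDatum.wt]) (by simp [CartanDatum.wt]) (Term.cupEF i) (.cupEF x i)

/-- The cap `Fᵢ Eᵢ 1ₓ → 1ₓ⟨1 + xᵢ⟩`. -/
def capFE (B : BubbleParams Q) (i : I) (x : X) :=
  diagram B x x (by simp [CartanDatum.wt]) (by simp [CartanDatum.wt]) (Term.capFE i) (.capFE x i)

/-- The cap `Eᵢ Fᵢ 1ₓ → 1ₓ⟨1 - xᵢ⟩`. -/
def capEF (B : BubbleParams Q) (i : I) (x : X) :=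
  diagram B x x (by simp [CartanDatum.wt]) (by simp [CartanDatum.wt]) (Term.capEF i) (.capEF x i)

/-- The grading shift `M⟨t⟩` of a 1-morphism. -/
def shift {B : BubbleParams Q} {a b : U B} (t : ℤ) (M : a ⟶ b) : a ⟶ b :=
  (⟨M.ι, fun i => ⟨(M.X i).word, (M.X i).shift + t, (M.X i).target⟩⟩ :
    Mat_ (ShiftedWord B a.obj b.obj))

/-- The grading shift on 2-morphisms. -/
def shiftMap {B : BubbleParams Q} {a b : U B} (t : ℤ) {M N : a ⟶ b} (η : M ⟶ N) :
    shift t M ⟶ shift t N :=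
  fun i j => ⟨(η i j).1, by
    have := (η i j).2
    change _ ∈ Hom2.degPart B _ _ _ (((N.X j).shift + t) - ((M.X i).shift + t))
    rwa [add_sub_add_right_eq_sub]⟩

/-- A summand of a formal direct sum. -/
def summand {B : BubbleParams Q} {a b : U B} (M : a ⟶ b) (i : M.ι) : a ⟶ b :=
  (Mat_.embedding (ShiftedWord B a.obj b.obj)).obj (M.X i)

/-- An entry of a matrix of 2-morphisms. -/
def entry {B : BubbleParams Q} {a b : U B} {M N : a ⟶ b} (η : M ⟶ N) (i : M.ι) (j : N.ι) :
    summand M i ⟶ summand N j :=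
  (Mat_.embedding (ShiftedWord B a.obj b.obj)).map (η i j)

/-- The same object, for other bubble parameters. -/
def toObj {B : BubbleParams Q} (B' : BubbleParams Q) (a : U B) : U B' := ⟨⟨a.obj.wt⟩⟩

/-- The same 1-morphism (a formal direct sum of shifted words), for other bubble parameters. -/
def toHom {B : BubbleParams Q} (B' : BubbleParams Q) {a b : U B} (M : a ⟶ b) :
    toObj B' a ⟶ toObj B' b :=
  (⟨M.ι, fun i => ⟨(M.X i).word, (M.X i).shift, (M.X i).target⟩⟩ :
    Mat_ (ShiftedWord B' ⟨a.obj.wt⟩ ⟨b.obj.wt⟩))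

end U

/-- An isomorphism `U_{Q,β} → U_{Q,β'}` of graded additive `𝕜`-linear 2-categories which is the
identity on objects and on 1-morphisms: linear bijections on the spaces of 2-morphisms that
preserve identities, vertical and horizontal composition, the structure isomorphisms, the grading
shifts and the decomposition of matrices into entries. -/
structure TwoIso (B B' : BubbleParams Q) where
  map₂ : ∀ {a b : U B} {M N : a ⟶ b}, (M ⟶ N) ≃ₗ[𝕜] (U.toHom B' M ⟶ U.toHom B' N)
  map₂_id : ∀ {a b : U B} (M : a ⟶ b), map₂ (𝟙 M) = 𝟙 (U.toHom B' M)
  map₂_comp : ∀ {a b : U B} {M N K : a ⟶ b} (η : M ⟶ N) (θ : N ⟶ K),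
    map₂ (η ≫ θ) = map₂ η ≫ map₂ θ
  map₂_whiskerLeft : ∀ {a b c : U B} (M : a ⟶ b) {N K : b ⟶ c} (η : N ⟶ K),
    map₂ (M ◁ η) = U.toHom B' M ◁ map₂ η
  map₂_whiskerRight : ∀ {a b c : U B} {M N : a ⟶ b} (η : M ⟶ N) (K : b ⟶ c),
    map₂ (η ▷ K) = map₂ η ▷ U.toHom B' K
  map₂_associator : ∀ {a b c d : U B} (M : a ⟶ b) (N : b ⟶ c) (K : c ⟶ d),
    map₂ (α_ M N K).hom = (α_ (U.toHom B' M) (U.toHom B' N) (U.toHom B' K)).hom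
  map₂_leftUnitor : ∀ {a b : U B} (M : a ⟶ b), map₂ (λ_ M).hom = (λ_ (U.toHom B' M)).hom
  map₂_rightUnitor : ∀ {a b : U B} (M : a ⟶ b), map₂ (ρ_ M).hom = (ρ_ (U.toHom B' M)).hom
  map₂_shift : ∀ {a b : U B} (t : ℤ) {M N : a ⟶ b} (η : M ⟶ N),
    map₂ (U.shiftMap t η) = U.shiftMap t (map₂ η)
  map₂_entry : ∀ {a b : U B} {M N : a ⟶ b} (η : M ⟶ N) (i : M.ι) (j : N.ι),
    map₂ (U.entry η i j) = U.entry (map₂ η) i j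

/-- The underlying strict 2-functor. -/
def TwoIso.toStrictPseudofunctor {B B' : BubbleParams Q} (Φ : TwoIso B B') :
    StrictPseudofunctor (U B) (U B') :=
  StrictPseudofunctor.mk'
    { obj := U.toObj B'
      map := U.toHom B'
      map₂ := fun η => Φ.map₂ η
      map₂_id := Φ.map₂_id
      map₂_comp := Φ.map₂_comp
      map_id := fun _ => rfl
      map_comp := fun _ _ => rfl
      map₂_whisker_left := fun M N K η => by
        refine (Φ.map₂_whiskerLeft M η).trans ?_
        exact ((Category.id_comp _).trans (Category.comp_id _)).symm
      map₂_whisker_right := fun η K => by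
        refine (Φ.map₂_whiskerRight η K).trans ?_
        exact ((Category.id_comp _).trans (Category.comp_id _)).symm
      map₂_left_unitor := fun M => (Φ.map₂_leftUnitor M).trans (Category.id_comp _).symm
      map₂_right_unitor := fun M => (Φ.map₂_rightUnitor M).trans (Category.id_comp _).symm
      map₂_associator := fun M N K => by
        refine (Φ.map₂_associator M N K).trans ?_
        exact ((Category.id_comp _).trans (Category.comp_id _)).symm }

end TheTwoCategory

end CatQG

end

open CategoryTheory

noncomputable section

namespace CatQG

universe u₁ u₂ u₃

open Letter

/-! ### Rescalings of the generating diagrams -/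

variable {𝕜 : Type u₁} [Field 𝕜] {I : Type u₂} {X : Type u₃} [AddCommGroup X]
  {D : CartanDatum I X} {Q : Scalars 𝕜 D}

/-! The isomorphism keeps dots and upward crossings and multiplies every cup, cap and fake bubble by
a nonzero scalar depending on its label `i` and the weight `x` of the region to its right. Such a
rescaling descends to 2-morphisms when it carries each relation for the source parameters to a
consequence of the relations for the target parameters.

Let `r` be the quotient of the `c⁺` of source and target, and let `e` be any family of units, used
as the factor of the cup `1 → E F`. The rest is forced. The cap `E F → 1` must get `r / e`, so that
the clockwise bubble is scaled by `r` and its degree zero value comes out right. The zigzag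
identities then give the factors of the other cup and cap, which involve `e` and `r` at `x + αᵢ`.
The counterclockwise bubble is scaled by `r(x + αᵢ)⁻¹`; this is the correct factor because the
axioms imply `c⁻(x) = c⁺(x + αᵢ)⁻¹`.

Two properties of `r` do the remaining work. For `j ≠ i`, `rᵢ` is invariant under `αⱼ`, since both
families of parameters use the same `t i j`; hence the mixed relations and the cyclicity of
crossings survive. Along `αᵢ`, `r(x) / r(x + αᵢ) = β'/β`; this is the factor of the double sideways
crossing, of a product of opposite bubbles and of every term of the `sl₂` sums, so `β` is replaced
by `β'`. All relations are collected in `mk_tr_eq_of_rel`. Any two compatible families of parameters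
are therefore isomorphic, for every gauge `e`, with inverse given by the gauge `e⁻¹`.

The stated formulas come from one particular gauge, `cyclicGauge`: `1/c⁺` if `λᵢ ≡ 2, 3` mod 4, and
`1` otherwise. -/

/-- A rescaling of the cups, caps and star bubbles, depending on the weight to their right. -/
structure Rescaling (𝕜 : Type u₁) [Field 𝕜] (I : Type u₂) (X : Type u₃) where
  cupFE : I → X → 𝕜
  cupEF : I → X → 𝕜
  capFE : I → X → 𝕜
  capEF : I → X → 𝕜
  cw : I → X → 𝕜
  ccw : I → X → 𝕜

/-- The action of a rescaling on diagrams whose rightmost region has weight `x`. -/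
def Rescaling.tr (D : CartanDatum I X) (S : Rescaling 𝕜 I X) :
    X → ∀ {u v : Word I}, Term 𝕜 I u v → Term 𝕜 I u v
  | _, _, _, .eqHom h => .eqHom h
  | x, _, _, .comp f g => .comp (S.tr D x f) (S.tr D x g)
  | x, _, _, .wl a f => .wl a (S.tr D x f)
  | x, _, _, .wr f b => .wr (S.tr D (x + D.wt b) f) b
  | _, _, _, .zero => .zero
  | x, _, _, .add f g => .add (S.tr D x f) (S.tr D x g)
  | x, _, _, .smul c f => .smul c (S.tr D x f)
  | _, _, _, .dot i => .dot i
  | _, _, _, .cross i j => .cross i j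
  | x, _, _, .cupFE i => .smul (S.cupFE i x) (.cupFE i)
  | x, _, _, .cupEF i => .smul (S.cupEF i x) (.cupEF i)
  | x, _, _, .capFE i => .smul (S.capFE i x) (.capFE i)
  | x, _, _, .capEF i => .smul (S.capEF i x) (.capEF i)
  | x, _, _, .cwStar i j => .smul (S.cw i x) (.cwStar i j)
  | x, _, _, .ccwStar i j => .smul (S.ccw i x) (.ccwStar i j)

/-- Generators are only replaced by scalar multiples of themselves, so the induced map respects the
grading and acts on 2-morphisms between shifted words. -/
theorem HasDegree.tr (S : Rescaling 𝕜 I X) {x : X} {u v : Word I} {f : Term 𝕜 I u v} {d : ℤ}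
    (h : HasDegree D x f d) : HasDegree D x (S.tr D x f) d := by
  induction h with
  | comp x _ _ h₁ h₂ => exact .comp x h₁ h₂
  | wl x a _ h => exact .wl x a h
  | wr x b _ h => exact .wr x b h
  | add x _ _ h₁ h₂ => exact .add x h₁ h₂
  | smul x c _ h => exact .smul x c h
  | eqHom => exact .eqHom _ _
  | zero => exact .zero _ _
  | dot => exact .dot _ _
  | cross => exact .cross _ _ _
  | cupFE => exact .smul _ _ (.cupFE _ _)
  | cupEF => exact .smul _ _ (.cupEF _ _)
  | capFE => exact .smul _ _ (.capFE _ _)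
  | capEF => exact .smul _ _ (.capEF _ _)
  | cwStar => exact .smul _ _ (.cwStar _ _ _)
  | ccwStar => exact .smul _ _ (.ccwStar _ _ _)

/-! ### Calculus of the scalar factors of diagrams -/

namespace Hom2

variable {B : BubbleParams Q} {x y : X} {u v w : Word I}

theorem smul_comp_smul (a b : 𝕜) (f : Hom2 B x u v) (g : Hom2 B x v w) :
    (a • f).comp (b • g) = (a * b) • f.comp g := by
  induction f using ind with | _ f
  induction g using ind with | _ g
  rw [mul_smul]
  exact (sound (Rel.smul_comp x a f (g.smul b))).trans
    (congrArg (a • ·) (sound (Rel.comp_smul x b f g)))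

theorem wl_smul (a : 𝕜) (w : Word I) (f : Hom2 B x u v) : (a • f).wl w = a • f.wl w := by
  induction f using ind with | _ f
  exact sound (Rel.wl_smul x w a f)

theorem smul_wr (a : 𝕜) (w : Word I) (h : x + D.wt w = y) (f : Hom2 B y u v) :
    (a • f).wr w h = a • f.wr w h := by
  subst h
  induction f using ind with | _ f
  exact sound (Rel.smul_wr x a f w)

end Hom2

/-- The rescaling `S` multiplies the 2-morphism represented by `f` by `s`. -/
def Rescaling.Scales (S : Rescaling 𝕜 I X) (B : BubbleParams Q) (x : X) {u v : Word I}
    (f : Term 𝕜 I u v) (s : 𝕜) : Prop :=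
  Hom2.mk B x (S.tr D x f) = s • Hom2.mk B x f

namespace Rescaling.Scales

variable {S : Rescaling 𝕜 I X} {B : BubbleParams Q} {x : X} {u v w : Word I}

theorem comp {f : Term 𝕜 I u v} {g : Term 𝕜 I v w} {a b : 𝕜} (hf : S.Scales B x f a)
    (hg : S.Scales B x g b) : S.Scales B x (f.comp g) (a * b) :=
  (congrArg₂ Hom2.comp hf hg).trans (Hom2.smul_comp_smul _ _ _ _)

theorem wl (a : Word I) {f : Term 𝕜 I u v} {s : 𝕜} (hf : S.Scales B x f s) :
    S.Scales B x (f.wl a) s :=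
  (congrArg (Hom2.wl a) hf).trans (Hom2.wl_smul _ _ _)

theorem wr (b : Word I) {f : Term 𝕜 I u v} {s : 𝕜} (hf : S.Scales B (x + D.wt b) f s) :
    S.Scales B x (f.wr b) s :=
  (congrArg (Hom2.wr b rfl) hf).trans (Hom2.smul_wr _ _ _ _)

theorem add {f g : Term 𝕜 I u v} {s : 𝕜} (hf : S.Scales B x f s) (hg : S.Scales B x g s) :
    S.Scales B x (f.add g) s :=
  (congrArg₂ (· + ·) hf hg).trans (_root_.smul_add _ _ _).symm

/-- The factor of the zero diagram is arbitrary, so a relation `f = 0` survives as soon as `f` is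
scaled by any scalar. -/
theorem zero (s : 𝕜) : S.Scales B x (Term.zero : Term 𝕜 I u v) s :=
  (smul_zero s).symm

theorem one (u : Word I) : S.Scales B x (Term.one u) 1 := (one_smul _ _).symm

theorem dot (i : I) : S.Scales B x (Term.dot i) 1 := (one_smul _ _).symm

theorem cross (i j : I) : S.Scales B x (Term.cross i j) 1 := (one_smul _ _).symm

theorem cupFE (i : I) : S.Scales B x (Term.cupFE i) (S.cupFE i x) := rfl

theorem cupEF (i : I) : S.Scales B x (Term.cupEF i) (S.cupEF i x) := rfl

theorem capFE (i : I) : S.Scales B x (Term.capFE i) (S.capFE i x) := rfl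

theorem capEF (i : I) : S.Scales B x (Term.capEF i) (S.capEF i x) := rfl

theorem cwStar (i : I) (j : ℕ) : S.Scales B x (Term.cwStar i j) (S.cw i x) := rfl

theorem ccwStar (i : I) (j : ℕ) : S.Scales B x (Term.ccwStar i j) (S.ccw i x) := rfl

theorem npow {f : Term 𝕜 I u u} (hf : S.Scales B x f 1) (n : ℕ) :
    S.Scales B x (f.npow n) 1 := by
  induction n with
  | zero => exact one u
  | succ n ih => simpa [Term.npow] using ih.comp hf

theorem sum {ι : Type*} (l : List ι) {f : ι → Term 𝕜 I u v} {s : 𝕜}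
    (hf : ∀ i ∈ l, S.Scales B x (f i) s) : S.Scales B x (Term.sum (l.map f)) s := by
  induction l with
  | nil => exact zero s
  | cons i l ih =>
    exact (hf i (by simp)).add (ih fun j hj => hf j (by simp [hj]))

theorem of_eq {f : Term 𝕜 I u v} {s t : 𝕜} (hf : S.Scales B x f s) (h : s = t) :
    S.Scales B x f t := h ▸ hf

/-- Equal 2-morphisms that are scaled by the same factor have equal images. -/
theorem sound {f g : Term 𝕜 I u v} {s : 𝕜} (hf : S.Scales B x f s) (hg : S.Scales B x g s)
    (h : Rel B x f g) : Hom2.mk B x (S.tr D x f) = Hom2.mk B x (S.tr D x g) :=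
  hf.trans ((congrArg (s • ·) (Hom2.sound h)).trans hg.symm)

end Rescaling.Scales

/-! ### Quotients of bubble parameters -/

namespace BubbleParams

/-- The factor `-β` in the step of `c⁺` along `αᵢ` cancels the value `-1/β` of `c⁺ c⁻`. Hence `c⁻`
is determined by `c⁺`, and quotients of `c⁺` suffice to compare two families of parameters. -/
theorem cm_eq (B : BubbleParams Q) (i : I) (x : X) : B.cm i x = (B.cp i (x + D.α i))⁻¹ := by
  rw [B.cp_add_self, eq_inv_iff_mul_eq_one, mul_left_comm, mul_comm (B.cm i x), B.cp_mul_cm]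
  simp

/-- The quotient of the parameters `c⁺` of `B` and `B'`. -/
def ratio (B B' : BubbleParams Q) (i : I) (x : X) : 𝕜ˣ := B.cp i x / B'.cp i x

theorem ratio_mul_cp (B B' : BubbleParams Q) (i : I) (x : X) :
    (B.ratio B' i x : 𝕜) * B'.cp i x = B.cp i x := by
  rw [← Units.val_mul, ratio, div_mul_cancel]

theorem inv_ratio_mul_cm (B B' : BubbleParams Q) (i : I) (x : X) :
    (B.ratio B' i (x + D.α i) : 𝕜)⁻¹ * B'.cm i x = B.cm i x := by
  rw [cm_eq, cm_eq, ratio, ← Units.val_inv_eq_inv_val, ← Units.val_mul, inv_div, div_mul_eq_mul_div,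
    mul_inv_cancel, one_div]

theorem inv_ratio (B B' : BubbleParams Q) (i : I) (x : X) :
    (B.ratio B' i x)⁻¹ = B'.ratio B i x := by
  simp [ratio]

/-- Both numerator and denominator change by the same scalar `t i j`; compatibility with a common
`Q` enters here. -/
theorem ratio_sub_of_ne (B B' : BubbleParams Q) {i j : I} (h : i ≠ j) (x : X) :
    B.ratio B' i (x - D.α j) = B.ratio B' i x := by
  have h₁ := B.cp_add_of_ne i j (x - D.α j) h
  have h₂ := B'.cp_add_of_ne i j (x - D.α j) h
  rw [sub_add_cancel] at h₁ h₂
  rw [ratio, ratio, h₁, h₂, mul_div_mul_left_eq_div]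

/-- Along its own root the quotient is not invariant: its variation is exactly the quotient of the
two `β`, which is what the `sl₂` relations need. -/
theorem ratio_add_self (B B' : BubbleParams Q) (i : I) (x : X) :
    (B.ratio B' i (x + D.α i) : 𝕜) * B'.β i x = B.β i x * B.ratio B' i x := by
  rw [ratio, ratio, B.cp_add_self, B'.cp_add_self, neg_mul, neg_mul, neg_div_neg_eq,
    mul_div_mul_comm, ← Units.val_mul, ← Units.val_mul, mul_right_comm, div_mul_cancel]

/-- The rescaling that takes the bubble parameters `B` to `B'` and multiplies the cups
`1 → Eᵢ Fᵢ` by `e`. -/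
def rescaling (B B' : BubbleParams Q) (e : I → X → 𝕜ˣ) : Rescaling 𝕜 I X where
  cupFE i x := e i (x + D.α i) / B.ratio B' i (x + D.α i)
  cupEF i x := e i x
  capFE i x := (e i (x + D.α i) : 𝕜)⁻¹
  capEF i x := B.ratio B' i x / e i x
  cw i x := B.ratio B' i x
  ccw i x := (B.ratio B' i (x + D.α i) : 𝕜)⁻¹

end BubbleParams

/-! ### Scalar factors of the diagrams in the relations -/

section

open Rescaling.Scales

variable (B B' : BubbleParams Q) (e : I → X → 𝕜ˣ)

local notation "S" => BubbleParams.rescaling B B' e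

/-- The cup sits at `x` and the cap at `x + αᵢ`, because of the strand to its right. This offset is
why the factors of `cupFE` and `capFE` are evaluated at `x + αᵢ`. -/
theorem scales_zigzag_E (x : X) (i : I) : (S).Scales B' x
    (((Term.cupFE i).wl [E i]).comp ((Term.capEF i).wr [E i])) 1 := by
  refine of_eq (comp (wl _ (cupFE i)) (wr _ (capEF i))) ?_
  have h : x + D.wt [E i] = x + D.α i := by simp [CartanDatum.wt]
  simp only [BubbleParams.rescaling, h]
  field_simp

theorem scales_zigzag_F (x : X) (i : I) : (S).Scales B' x
    (((Term.cupFE i).wr [F i]).comp ((Term.capEF i).wl [F i])) 1 := by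
  refine of_eq (comp (wr _ (cupFE i)) (wl _ (capEF i))) ?_
  have h : x + D.wt [F i] + D.α i = x := by simp [CartanDatum.wt]
  simp only [BubbleParams.rescaling, h]
  field_simp

theorem scales_zigzag_E' (x : X) (i : I) : (S).Scales B' x
    (((Term.cupEF i).wr [E i]).comp ((Term.capFE i).wl [E i])) 1 := by
  refine of_eq (comp (wr _ (cupEF i)) (wl _ (capFE i))) ?_
  have h : x + D.wt [E i] = x + D.α i := by simp [CartanDatum.wt]
  simp only [BubbleParams.rescaling, h]
  field_simp

theorem scales_zigzag_F' (x : X) (i : I) : (S).Scales B' x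
    (((Term.cupEF i).wl [F i]).comp ((Term.capFE i).wr [F i])) 1 := by
  refine of_eq (comp (wl _ (cupEF i)) (wr _ (capFE i))) ?_
  have h : x + D.wt [F i] + D.α i = x := by simp [CartanDatum.wt]
  simp only [BubbleParams.rescaling, h]
  field_simp

theorem scales_downDot (x : X) (i : I) : (S).Scales B' x (Term.downDot i) 1 := by
  refine of_eq (comp (wl _ (cupEF i)) (comp (wl _ (wr _ (dot i))) (wr _ (capFE i)))) ?_
  have h : x + D.wt [F i] + D.α i = x := by simp [CartanDatum.wt]
  simp only [BubbleParams.rescaling, h]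
  field_simp

theorem scales_downDot' (x : X) (i : I) : (S).Scales B' x (Term.downDot' i) 1 := by
  refine of_eq (comp (wr _ (cupFE i)) (comp (wl _ (wr _ (dot i))) (wl _ (capEF i)))) ?_
  have h : x + D.wt [F i] + D.α i = x := by simp [CartanDatum.wt]
  simp only [BubbleParams.rescaling, h]
  field_simp

/-- The factor need not be `1`; cyclicity only requires that it agrees with the factor of the
opposite rotation. This rotation uses `cupFE` and `capEF`, so quotients of parameters occur and have
to cancel. -/
theorem scales_downCross (x : X) (i j : I) : (S).Scales B' x (Term.downCross i j)
    (e i x * e j (x - D.α i) / (e j x * e i (x - D.α j))) := by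
  refine of_eq (comp (wr _ (cupFE j)) (comp (wl _ (wr _ (cupFE i)))
    (comp (wl _ (wr _ (cross i j))) (comp (wl _ (wr _ (capEF i))) (wl _ (capEF j)))))) ?_
  have h₁ : x + D.wt [F i, F j] + D.α j = x - D.α i := by simp [CartanDatum.wt]; abel
  have h₂ : x + D.wt [E j, F i, F j] + D.α i = x := by simp [CartanDatum.wt]
  have h₃ : x + D.wt [F j] = x - D.α j := by simp [CartanDatum.wt]; abel
  simp only [BubbleParams.rescaling, h₁, h₂, h₃]
  -- For `i = j` the four quotients cancel in pairs as they stand, whereas for `i ≠ j` they cancel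
  -- only by their invariance under the other root.
  by_cases hij : i = j
  · subst hij
    field_simp
  · rw [B.ratio_sub_of_ne B' hij, B.ratio_sub_of_ne B' (Ne.symm hij)]
    field_simp

theorem scales_downCross' (x : X) (i j : I) : (S).Scales B' x (Term.downCross' i j)
    (e i x * e j (x - D.α i) / (e j x * e i (x - D.α j))) := by
  refine of_eq (comp (wl _ (cupEF i)) (comp (wl _ (wr _ (cupEF j)))
    (comp (wl _ (wr _ (cross i j))) (comp (wl _ (wr _ (capFE j))) (wr _ (capFE i)))))) ?_
  have h₁ : x + D.wt [F i] = x - D.α i := by simp [CartanDatum.wt]; abel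
  have h₂ : x + D.wt [E i, F j, F i] + D.α j = x := by simp [CartanDatum.wt]
  have h₃ : x + D.wt [F j, F i] + D.α i = x - D.α j := by simp [CartanDatum.wt]; abel
  simp only [BubbleParams.rescaling, h₁, h₂, h₃]
  field_simp

theorem scales_sideEF (x : X) (i j : I) : (S).Scales B' x (Term.sideEF i j)
    (e j (x + D.α i) * B.ratio B' j x / (e j x * B.ratio B' j (x + D.α i))) := by
  refine of_eq (comp (wr _ (cupFE j)) (comp (wl _ (wr _ (cross j i))) (wl _ (capEF j)))) ?_
  have h : x + D.wt [E i, F j] + D.α j = x + D.α i := by simp [CartanDatum.wt]; abel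
  simp only [BubbleParams.rescaling, h]
  field_simp

/-- Here only the gauge contributes, and it is inverse to the gauge part of `scales_sideEF` with the
labels exchanged. Composites of the two sideways crossings are thus independent of `e`. -/
theorem scales_sideFE (x : X) (i j : I) : (S).Scales B' x (Term.sideFE i j)
    (e i x / e i (x + D.α j)) := by
  refine of_eq (comp (wl _ (cupEF i)) (comp (wl _ (wr _ (cross j i))) (wr _ (capFE i)))) ?_
  have h : x + D.wt [E j, F i] + D.α i = x + D.α j := by simp [CartanDatum.wt]; abel
  simp only [BubbleParams.rescaling, h]
  field_simp

/-- This is the product of the factors of the two opposite bubbles, and also the factor common to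
all diagrams multiplied by `β` in the `sl₂` relations. -/
theorem ratio_div_ratio_add_self (x : X) (i : I) :
    (B.ratio B' i x : 𝕜) / B.ratio B' i (x + D.α i) = B'.β i x / B.β i x := by
  have h := B.ratio_add_self B' i x
  field_simp
  linear_combination -h

theorem ratio_add_of_ne {i j : I} (h : i ≠ j) (x : X) :
    B.ratio B' i (x + D.α j) = B.ratio B' i x := by
  rw [← B.ratio_sub_of_ne B' h, add_sub_cancel_right]

theorem scales_sideFE_sideEF (x : X) (i j : I) (h : i ≠ j) :
    (S).Scales B' x ((Term.sideFE j i).comp (Term.sideEF i j)) 1 := by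
  refine of_eq (comp (scales_sideFE B B' e x j i) (scales_sideEF B B' e x i j)) ?_
  rw [ratio_add_of_ne B B' h.symm]
  field_simp

theorem scales_sideEF_sideFE (x : X) (i j : I) (h : i ≠ j) :
    (S).Scales B' x ((Term.sideEF i j).comp (Term.sideFE j i)) 1 := by
  refine of_eq (comp (scales_sideEF B B' e x i j) (scales_sideFE B B' e x j i)) ?_
  rw [ratio_add_of_ne B B' h.symm]
  field_simp

theorem scales_sideFE_sideEF_self (x : X) (i : I) :
    (S).Scales B' x ((Term.sideFE i i).comp (Term.sideEF i i)) (B'.β i x / B.β i x) := by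
  refine of_eq (comp (scales_sideFE B B' e x i i) (scales_sideEF B B' e x i i)) ?_
  rw [← ratio_div_ratio_add_self]
  field_simp

theorem scales_sideEF_sideFE_self (x : X) (i : I) :
    (S).Scales B' x ((Term.sideEF i i).comp (Term.sideFE i i)) (B'.β i x / B.β i x) := by
  refine of_eq (comp (scales_sideEF B B' e x i i) (scales_sideFE B B' e x i i)) ?_
  rw [← ratio_div_ratio_add_self]
  field_simp

theorem scales_cwBubble (x : X) (i : I) (m : ℕ) :
    (S).Scales B' x (Term.cwBubble i m) (B.ratio B' i x) := by
  refine of_eq (comp (cupEF i) (comp (wr _ (npow (dot i) m)) (capEF i))) ?_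
  simp only [BubbleParams.rescaling]
  field_simp

theorem scales_ccwBubble (x : X) (i : I) (m : ℕ) :
    (S).Scales B' x (Term.ccwBubble i m) (B.ratio B' i (x + D.α i) : 𝕜)⁻¹ := by
  refine of_eq (comp (cupFE i) (comp (wl _ (npow (dot i) m)) (capFE i))) ?_
  simp only [BubbleParams.rescaling]
  field_simp

/-- The factor of a star bubble does not depend on its degree, so all summands are scaled alike. -/
theorem scales_grassmannian (x : X) (i : I) (j : ℕ) :
    (S).Scales B' x (Term.grassmannian i j) (B'.β i x / B.β i x) := by
  refine sum _ fun p _ => of_eq (comp (cwStar i p.1) (ccwStar i p.2)) ?_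
  rw [← ratio_div_ratio_add_self, div_eq_mul_inv]
  rfl

/-- In each summand the cap and the cup contribute `r(x)` together, free of the gauge, the bubble
contributes `r(x + αᵢ)⁻¹`, and dots contribute nothing. -/
theorem scales_sumEF (x : X) (i : I) (m : ℤ) :
    (S).Scales B' x (Term.sumEF i m) (B'.β i x / B.β i x) := by
  refine sum _ fun f _ => of_eq (comp (wl _ (npow (scales_downDot B B' e x i) _))
    (comp (capEF i) (comp (ccwStar i (f 1))
    (comp (cupEF i) (wl _ (npow (scales_downDot B B' e x i) _)))))) ?_
  rw [← ratio_div_ratio_add_self]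
  simp only [BubbleParams.rescaling]
  field_simp

theorem scales_sumFE (x : X) (i : I) (m : ℤ) :
    (S).Scales B' x (Term.sumFE i m) (B'.β i x / B.β i x) := by
  refine sum _ fun f _ => of_eq (comp (wl _ (npow (dot i) _)) (comp (capFE i)
    (comp (cwStar i (f 1)) (comp (cupFE i) (wl _ (npow (dot i) _)))))) ?_
  rw [← ratio_div_ratio_add_self]
  simp only [BubbleParams.rescaling]
  field_simp

end

/-! ### Compatibility of the rescaling with all relations -/

theorem Rescaling.Scales.smul_of_eq {S : Rescaling 𝕜 I X} {B : BubbleParams Q} {x : X}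
    {u v : Word I} {f : Term 𝕜 I u v} {s c d : 𝕜} (hf : S.Scales B x f s) (h : c * s = d) :
    Hom2.mk B x (S.tr D x (f.smul c)) = Hom2.mk B x (f.smul d) :=
  (congrArg (c • ·) hf).trans ((smul_smul _ _ _).trans (by rw [h]; rfl))

-- Structural and KLR relations contain no rescaled generator of their own and involve only `Q`, so
-- they are literally relations for `B'`. In the others either both sides carry the same factor, or
-- the factor converts the parameters of `B'` into those of `B`.
open Rescaling.Scales in
theorem mk_tr_eq_of_rel (B B' : BubbleParams Q) (e : I → X → 𝕜ˣ) {x : X} {u v : Word I}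
    {f g : Term 𝕜 I u v} (h : Rel B x f g) :
    Hom2.mk B' x ((B.rescaling B' e).tr D x f) = Hom2.mk B' x ((B.rescaling B' e).tr D x g) := by
  induction h with
  | comp_left x g _ ih => exact congrArg (Hom2.comp · (Hom2.mk B' x (Rescaling.tr D _ x g))) ih
  | comp_right x f _ ih => exact congrArg (Hom2.comp (Hom2.mk B' x (Rescaling.tr D _ x f))) ih
  | wl_congr x a _ ih => exact congrArg (Hom2.wl a) ih
  | wr_congr x b _ ih => exact congrArg (Hom2.wr b rfl) ih
  | add_left x g _ ih => exact congrArg (· + Hom2.mk B' x (Rescaling.tr D _ x g)) ih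
  | add_right x f _ ih => exact congrArg (Hom2.mk B' x (Rescaling.tr D _ x f) + ·) ih
  | smul_congr x c _ ih => exact congrArg (c • ·) ih
  | add_comm x f g => exact Hom2.sound (.add_comm _ _ _)
  | add_assoc x f g h => exact Hom2.sound (.add_assoc _ _ _ _)
  | zero_add x f => exact Hom2.sound (.zero_add _ _)
  | smul_add x c f g => exact Hom2.sound (.smul_add _ _ _ _)
  | add_smul x c d f => exact Hom2.sound (.add_smul _ _ _ _)
  | mul_smul x c d f => exact Hom2.sound (.mul_smul _ _ _ _)
  | one_smul x f => exact Hom2.sound (.one_smul _ _)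
  | zero_smul x f => exact Hom2.sound (.zero_smul _ _)
  | add_comp x f f' g => exact Hom2.sound (.add_comp _ _ _ _)
  | comp_add x f g g' => exact Hom2.sound (.comp_add _ _ _ _)
  | smul_comp x c f g => exact Hom2.sound (.smul_comp _ _ _ _)
  | comp_smul x c f g => exact Hom2.sound (.comp_smul _ _ _ _)
  | wl_add x a f g => exact Hom2.sound (.wl_add _ _ _ _)
  | wl_smul x a c f => exact Hom2.sound (.wl_smul _ _ _ _)
  | add_wr x f g b => exact Hom2.sound (.add_wr _ _ _ _)
  | smul_wr x c f b => exact Hom2.sound (.smul_wr _ _ _ _)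
  | id_comp x f => exact Hom2.sound (.id_comp _ _)
  | comp_id x f => exact Hom2.sound (.comp_id _ _)
  | assoc x f g h => exact Hom2.sound (.assoc _ _ _ _)
  | wl_id x a u => exact Hom2.sound (.wl_id _ _ _)
  | wl_comp x a f g => exact Hom2.sound (.wl_comp _ _ _ _)
  | id_wr x u b => exact Hom2.sound (.id_wr _ _ _)
  | comp_wr x f g b => exact Hom2.sound (.comp_wr _ _ _ _)
  | wl_nil x f => exact Hom2.sound (.wl_nil _ _)
  | wr_nil x f =>
    refine Eq.trans ?_ (Hom2.sound (.wr_nil _ _))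
    simp only [Rescaling.tr, CartanDatum.wt, _root_.add_zero]
  | wl_append x a b f => exact Hom2.sound (.wl_append _ _ _ _)
  | wr_append x f a b =>
    refine Eq.trans ?_ (Hom2.sound (.wr_append _ _ _ _))
    have h : x + D.wt (a ++ b) = x + D.wt b + D.wt a := by
      rw [CartanDatum.wt_append]; abel
    simp only [Rescaling.tr, h]
  | wl_wr x a f b => exact Hom2.sound (.wl_wr _ _ _ _)
  -- Sliding `g` past `f` changes the word to the right of `f` from `u'` to `v'`. Equality of their
  -- weights makes the rescaling of `f` the same on both sides.
  | exchange x f g h =>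
    refine (Hom2.sound (.exchange _ _ _ h)).trans ?_
    simp only [Rescaling.tr, h]
  | zigzag_E x i => exact sound (scales_zigzag_E B B' e x i) (one _) (.zigzag_E _ _)
  | zigzag_F x i => exact sound (scales_zigzag_F B B' e x i) (one _) (.zigzag_F _ _)
  | zigzag_E' x i => exact sound (scales_zigzag_E' B B' e x i) (one _) (.zigzag_E' _ _)
  | zigzag_F' x i => exact sound (scales_zigzag_F' B B' e x i) (one _) (.zigzag_F' _ _)
  | cyclic_dot x i =>
    exact sound (scales_downDot B B' e x i) (scales_downDot' B B' e x i) (.cyclic_dot _ _)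
  | cyclic_cross x i j =>
    exact sound (scales_downCross B B' e x i j) (scales_downCross' B B' e x i j)
      (.cyclic_cross _ _ _)
  | quad_self x i => exact Hom2.sound (.quad_self _ _)
  | quad_zero x i j h => exact Hom2.sound (.quad_zero _ _ _ h)
  | quad_neg_one x i j h => exact Hom2.sound (.quad_neg_one _ _ _ h)
  | nilHecke x i => exact Hom2.sound (.nilHecke _ _)
  | nilHecke' x i => exact Hom2.sound (.nilHecke' _ _)
  | dot_slide x i j h => exact Hom2.sound (.dot_slide _ _ _ h)
  | dot_slide' x i j h => exact Hom2.sound (.dot_slide' _ _ _ h)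
  | braid x i j k h => exact Hom2.sound (.braid _ _ _ _ h)
  | braid_neg_one x i j h => exact Hom2.sound (.braid_neg_one _ _ _ h)
  | mixed_FE x i j h =>
    exact sound (scales_sideFE_sideEF B B' e x i j h) (one _) (.mixed_FE _ _ _ h)
  | mixed_EF x i j h =>
    exact sound (scales_sideEF_sideFE B B' e x i j h) (one _) (.mixed_EF _ _ _ h)
  | cw_neg x i m h => exact sound (scales_cwBubble B B' e x i m) (zero _) (.cw_neg _ _ _ h)
  | ccw_neg x i m h => exact sound (scales_ccwBubble B B' e x i m) (zero _) (.ccw_neg _ _ _ h)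
  | cw_real x i j m h =>
    exact sound (cwStar i j) (scales_cwBubble B B' e x i m) (.cw_real _ _ _ _ h)
  | ccw_real x i j m h =>
    exact sound (ccwStar i j) (scales_ccwBubble B B' e x i m) (.ccw_real _ _ _ _ h)
  -- The two sides have different factors here: the star bubble takes its value from `B'`, and
  -- multiplication by the quotient restores the value prescribed by `B`.
  | cw_zero x i =>
    change (B.ratio B' i x : 𝕜) • Hom2.mk B' x (Term.cwStar i 0) =
      (B.cp i x : 𝕜) • Hom2.mk B' x (Term.one [])
    rw [Hom2.sound (.cw_zero x i), Hom2.mk_smul, smul_smul, B.ratio_mul_cp]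
  | ccw_zero x i =>
    change (B.ratio B' i (x + D.α i) : 𝕜)⁻¹ • Hom2.mk B' x (Term.ccwStar i 0) =
      (B.cm i x : 𝕜) • Hom2.mk B' x (Term.one [])
    rw [Hom2.sound (.ccw_zero x i), Hom2.mk_smul, smul_smul, B.inv_ratio_mul_cm]
  | inf_grassmannian x i j h =>
    exact sound (scales_grassmannian B B' e x i j) (zero _) (.inf_grassmannian _ _ _ h)
  -- The relation for `B'` is used, and each of its two terms is the image of the corresponding term
  -- for `B`, since `β · (β'/β) = β'`.
  | sl2_EF x i =>
    refine (Hom2.sound (.sl2_EF x i)).trans (Eq.symm (congrArg₂ (· + ·)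
      ((scales_sideEF_sideFE_self B B' e x i).smul_of_eq ?_)
      ((scales_sumEF B B' e x i _).smul_of_eq ?_))) <;> field_simp
  | sl2_FE x i =>
    refine (Hom2.sound (.sl2_FE x i)).trans (Eq.symm (congrArg₂ (· + ·)
      ((scales_sideFE_sideEF_self B B' e x i).smul_of_eq ?_)
      ((scales_sumFE B B' e x i _).smul_of_eq ?_))) <;> field_simp

/-! ### The induced bijections on spaces of 2-morphisms -/

namespace Hom2

/-- The map on 2-morphisms induced by `BubbleParams.rescaling`. -/
def rescale (B B' : BubbleParams Q) (e : I → X → 𝕜ˣ) (x : X) {u v : Word I} :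
    Hom2 B x u v →ₗ[𝕜] Hom2 B' x u v where
  toFun := Quot.lift (fun f => mk B' x ((B.rescaling B' e).tr D x f))
    fun _ _ h => mk_tr_eq_of_rel B B' e h
  map_add' f g := by
    induction f using ind with | _ f
    induction g using ind with | _ g
    rfl
  map_smul' c f := by
    induction f using ind with | _ f
    rfl

variable (B B' : BubbleParams Q) (e : I → X → 𝕜ˣ) {x y : X} {u v w : Word I}

theorem rescale_mk (f : Term 𝕜 I u v) :
    rescale B B' e x (mk B x f) = mk B' x ((B.rescaling B' e).tr D x f) := rfl

theorem rescale_comp (f : Hom2 B x u v) (g : Hom2 B x v w) :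
    rescale B B' e x (f.comp g) = (rescale B B' e x f).comp (rescale B B' e x g) := by
  induction f using ind with | _ f
  induction g using ind with | _ g
  rfl

theorem rescale_wl (a : Word I) (f : Hom2 B x u v) :
    rescale B B' e x (f.wl a) = (rescale B B' e x f).wl a := by
  induction f using ind with | _ f
  rfl

theorem rescale_wr (b : Word I) (h : x + D.wt b = y) (f : Hom2 B y u v) :
    rescale B B' e x (f.wr b h) = (rescale B B' e y f).wr b h := by
  subst h
  induction f using ind with | _ f
  rfl

theorem rescale_mem {f : Hom2 B x u v} {d : ℤ} (hf : f ∈ degPart B x u v d) :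
    rescale B B' e x f ∈ degPart B' x u v d := by
  obtain ⟨t, ht, rfl⟩ := hf
  exact ⟨_, ht.tr _, rfl⟩

/-- Exchanging `B` and `B'` inverts the quotient of parameters; inverting the gauge as well inverts
every factor. The induction must generalize the weight, since strands added on the right change it.
-/
theorem rescale_rescale_inv (f : Hom2 B x u v) :
    rescale B' B e⁻¹ x (rescale B B' e x f) = f := by
  induction f using ind with | _ f
  rw [rescale_mk, rescale_mk]
  induction f generalizing x with
  | comp f g hf hg => exact congrArg₂ comp hf hg
  | wl a f hf => exact congrArg (wl a) hf
  | wr f b hf => exact congrArg (wr b rfl) hf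
  | add f g hf hg => exact congrArg₂ (· + ·) hf hg
  | smul c f hf => exact congrArg (c • ·) hf
  | eqHom | zero | dot | cross => rfl
  | cupFE | cupEF | capFE | capEF | cwStar | ccwStar =>
    simp only [Rescaling.tr, mk_smul, smul_smul, BubbleParams.rescaling, ← B.inv_ratio B',
      Pi.inv_apply, Units.val_inv_eq_inv_val]
    convert one_smul 𝕜 _
    field_simp

end Hom2

/-! ### Extension to shifts, direct sums and matrices -/

/-- The functor between categories of shifted words induced by `Hom2.rescale`. -/
def rescaleFunctor (B B' : BubbleParams Q) (e : I → X → 𝕜ˣ) (x y : X) :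
    ShiftedWord B ⟨x⟩ ⟨y⟩ ⥤ ShiftedWord B' ⟨x⟩ ⟨y⟩ where
  obj f := ⟨f.word, f.shift, f.target⟩
  map η := ⟨Hom2.rescale B B' e x η.1, Hom2.rescale_mem B B' e η.2⟩
  map_id _ := rfl
  map_comp η θ := Subtype.ext (Hom2.rescale_comp B B' e η.1 θ.1)

instance (B B' : BubbleParams Q) (e : I → X → 𝕜ˣ) (x y : X) :
    (rescaleFunctor B B' e x y).Additive where
  map_add {_ _ η θ} := Subtype.ext (map_add (Hom2.rescale B B' e x) η.1 θ.1)

open Bicategory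

/-- The map on matrices of 2-morphisms induced by `Hom2.rescale`. -/
def rescaleEquiv (B B' : BubbleParams Q) (e : I → X → 𝕜ˣ) {a b : U B} (M N : a ⟶ b) :
    (M ⟶ N) ≃ₗ[𝕜] (U.toHom B' M ⟶ U.toHom B' N) where
  toFun η := (rescaleFunctor B B' e a.obj.wt b.obj.wt).mapMat_.map η
  invFun η := (rescaleFunctor B' B e⁻¹ a.obj.wt b.obj.wt).mapMat_.map η
  map_add' η θ := by
    funext i j
    exact Subtype.ext (map_add (Hom2.rescale B B' e _) (η i j).1 (θ i j).1)
  map_smul' c η := by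
    funext i j
    exact Subtype.ext (map_smul (Hom2.rescale B B' e _) c (η i j).1)
  left_inv η := by
    funext i j
    exact Subtype.ext (Hom2.rescale_rescale_inv B B' e (η i j).1)
  right_inv η := by
    funext i j
    -- The other composite is the same statement with the parameters exchanged and gauge `e⁻¹`,
    -- whose inverse is `e` again.
    have h := Hom2.rescale_rescale_inv B' B e⁻¹ (η i j).1
    rw [inv_inv] at h
    exact Subtype.ext h

section

variable (B B' : BubbleParams Q) (e : I → X → 𝕜ˣ) {a b c : U B}

theorem rescaleEquiv_id (M : a ⟶ b) :
    rescaleEquiv B B' e M M (𝟙 M) = 𝟙 (U.toHom B' M) :=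
  (rescaleFunctor B B' e a.obj.wt b.obj.wt).mapMat_.map_id M

theorem rescaleEquiv_comp {M N K : a ⟶ b} (η : M ⟶ N) (θ : N ⟶ K) :
    rescaleEquiv B B' e M K (η ≫ θ) = rescaleEquiv B B' e M N η ≫ rescaleEquiv B B' e N K θ :=
  (rescaleFunctor B B' e a.obj.wt b.obj.wt).mapMat_.map_comp η θ

/-- An entry of a horizontal composite is a single product of two whiskered entries, without a sum,
so the claim reduces to `Hom2.rescale`. Both whiskerings are the case of an identity matrix. -/
theorem rescaleEquiv_hcomp {M N : a ⟶ b} {K L : b ⟶ c} (η : M ⟶ N) (θ : K ⟶ L) :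
    rescaleEquiv B B' e (M ≫ K) (N ≫ L) (AddClosure.hcomp η θ) =
      AddClosure.hcomp (rescaleEquiv B B' e M N η) (rescaleEquiv B B' e K L θ) := by
  funext p q
  refine Subtype.ext ((Hom2.rescale_comp B B' e _ _).trans ?_)
  exact congrArg₂ Hom2.comp (Hom2.rescale_wl B B' e _ _)
    (Hom2.rescale_wr B B' e _ (N.X q.1).target _)

/-- The associator and the unitors are of this form, with identities between equal words as entries;
the rescaling fixes those. -/
theorem rescaleEquiv_reindexHom {M N : a ⟶ b} (σ : M.ι ≃ N.ι) (φ : ∀ i, M.X i ⟶ N.X (σ i)) :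
    rescaleEquiv B B' e M N (MatAux.reindexHom σ φ) =
      MatAux.reindexHom (M := U.toHom B' M) (N := U.toHom B' N) σ
        fun i => (rescaleFunctor B B' e a.obj.wt b.obj.wt).map (φ i) := by
  funext i j
  refine ((rescaleFunctor B B' e a.obj.wt b.obj.wt).map_comp _ _).trans ?_
  exact congrArg (_ ≫ ·) (congrFun (congrFun (rescaleEquiv_id B B' e N) (σ i)) j)

/-- The isomorphism of 2-categories induced by `BubbleParams.rescaling`. -/
def rescaleIso : TwoIso B B' where
  map₂ {_ _ M N} := rescaleEquiv B B' e M N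
  map₂_id M := rescaleEquiv_id B B' e M
  map₂_comp η θ := rescaleEquiv_comp B B' e η θ
  map₂_whiskerLeft M _ _ η := (rescaleEquiv_hcomp B B' e (𝟙 M) η).trans
    (congrArg (AddClosure.hcomp · _) (rescaleEquiv_id B B' e M))
  map₂_whiskerRight η K := (rescaleEquiv_hcomp B B' e η (𝟙 K)).trans
    (congrArg (AddClosure.hcomp _) (rescaleEquiv_id B B' e K))
  map₂_associator M N K := rescaleEquiv_reindexHom B B' e
    (M := (M ≫ N) ≫ K) (N := M ≫ N ≫ K) _ _
  map₂_leftUnitor M := rescaleEquiv_reindexHom B B' e (M := 𝟙 _ ≫ M) (N := M) _ _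
  map₂_rightUnitor M := rescaleEquiv_reindexHom B B' e (M := M ≫ 𝟙 _) (N := M) _ _
  map₂_shift _ _ _ _ := rfl
  map₂_entry _ _ _ := rfl

end

/-! ### The gauge for the cyclic 2-category -/

theorem CartanDatum.h_add_self (D : CartanDatum I X) (i : I) (x : X) :
    D.h i (x + D.α i) = D.h i x + 2 := by
  have h : D.h i (D.α i) = 2 := by
    have := (D.h_eq_form i (D.α i)).trans (D.form_self i)
    exact_mod_cast this
  rw [map_add, h]

/-- The factors by which the cups `1 → Eᵢ Fᵢ` are rescaled in the isomorphism out of the cyclic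
2-category. -/
def BubbleParams.cyclicGauge (B : BubbleParams Q) (i : I) (x : X) : 𝕜ˣ :=
  if D.h i x % 4 = 2 ∨ D.h i x % 4 = 3 then (B.cp i x)⁻¹ else 1

/-- Adding `αᵢ` raises `λᵢ` by 2 and so exchanges the residues `0, 1` with `2, 3` mod 4. The inverse
of `c⁺` at the shifted weight is then `c⁻` at `x`. -/
theorem BubbleParams.cyclicGauge_add_self (B : BubbleParams Q) (i : I) (x : X) :
    B.cyclicGauge i (x + D.α i) =
      if D.h i x % 4 = 0 ∨ D.h i x % 4 = 1 then B.cm i x else 1 := by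
  rw [cyclicGauge, D.h_add_self, B.cm_eq]
  exact if_congr (by omega) rfl rfl

/-- Scalar multiples of diagrams represent scalar multiples of 2-morphisms. -/
theorem U.diagram_smul (B : BubbleParams Q) (x y : X) {u v : Word I} (hu : x + D.wt u = y)
    (hv : x + D.wt v = y) (f : Term 𝕜 I u v) {d : ℤ} (hd : HasDegree D x f d) (c : 𝕜) :
    U.diagram B x y hu hv (f.smul c) (hd.smul x c) = c • U.diagram B x y hu hv f hd := by
  funext i j
  apply Subtype.ext
  obtain ⟨⟩ := i
  obtain ⟨⟩ := j
  change _ = c • (U.diagram B x y hu hv f hd PUnit.unit PUnit.unit).1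
  simp [U.diagram, Mat_.embedding]
  rfl

theorem U.smul_diagram_congr (B : BubbleParams Q) (x y : X) {u v : Word I} (hu : x + D.wt u = y)
    (hv : x + D.wt v = y) (f : Term 𝕜 I u v) {d : ℤ} (hd : HasDegree D x f d) {c c' : 𝕜}
    (h : c = c') :
    U.diagram B x y hu hv (f.smul c) (hd.smul x c) = c' • U.diagram B x y hu hv f hd :=
  h ▸ U.diagram_smul B x y hu hv f hd c

end CatQG

end

theorem mainTheorem1 {𝕜 : Type*} [Field 𝕜] {I : Type*} {X : Type*} [AddCommGroup X]
    [Module.Free ℤ X] (D : CatQG.CartanDatum I X) (Q : CatQG.Scalars 𝕜 D) (B₀ B : CatQG.BubbleParams Q)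
    (hB₀ : B₀.IsCyclic) :
    ∃ Φ : CatQG.TwoIso B₀ B,
      (∀ i x, Φ.map₂ (CatQG.U.dot B₀ i x) = CatQG.U.dot B i x) ∧
      (∀ i j x, Φ.map₂ (CatQG.U.cross B₀ i j x) = CatQG.U.cross B i j x) ∧
      (∀ i x, Φ.map₂ (CatQG.U.capEF B₀ i x) =
        (if D.h i x % 4 = 0 ∨ D.h i x % 4 = 1 then (B₀.cp i x : 𝕜) / B.cp i x
          else (B₀.cp i x : 𝕜)) • CatQG.U.capEF B i x) ∧
      (∀ i x, Φ.map₂ (CatQG.U.capFE B₀ i x) =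
        (if D.h i x % 4 = 0 ∨ D.h i x % 4 = 1 then 1 / (B.cm i x : 𝕜) else 1) •
          CatQG.U.capFE B i x) ∧
      (∀ i x, Φ.map₂ (CatQG.U.cupEF B₀ i x) =
        (if D.h i x % 4 = 2 ∨ D.h i x % 4 = 3 then 1 / (B.cp i x : 𝕜) else 1) •
          CatQG.U.cupEF B i x) ∧
      (∀ i x, Φ.map₂ (CatQG.U.cupFE B₀ i x) =
        (if D.h i x % 4 = 2 ∨ D.h i x % 4 = 3 then (B₀.cp i x : 𝕜)⁻¹ / B.cm i x
          else (B₀.cp i x : 𝕜)⁻¹) • CatQG.U.cupFE B i x) := by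
  have hcm (i : I) (x : X) : (B.cm i x : 𝕜) = (B.cp i (x + D.α i) : 𝕜)⁻¹ := by
    rw [B.cm_eq, Units.val_inv_eq_inv_val]
  -- With `β = -1` the source parameter is constant along the root string. Its value at `x + αᵢ`,
  -- which occurs in the factor of `cupFE`, can thus be read off at `x`.
  have hc (i : I) (x : X) : (B₀.cp i (x + D.α i) : 𝕜) = B₀.cp i x := by
    rw [B₀.cp_add_self, hB₀, neg_neg, one_mul]
  have hne (i : I) (x : X) : (D.h i x % 4 = 2 ∨ D.h i x % 4 = 3) ↔
      ¬(D.h i x % 4 = 0 ∨ D.h i x % 4 = 1) := by omega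
  refine ⟨CatQG.rescaleIso B₀ B B.cyclicGauge, fun i x => rfl, fun i j x => rfl,
    fun i x => CatQG.U.smul_diagram_congr _ _ _ _ _ _ _ ?_,
    fun i x => CatQG.U.smul_diagram_congr _ _ _ _ _ _ _ ?_,
    fun i x => CatQG.U.smul_diagram_congr _ _ _ _ _ _ _ ?_,
    fun i x => CatQG.U.smul_diagram_congr _ _ _ _ _ _ _ ?_⟩
  · change (B₀.ratio B i x : 𝕜) / B.cyclicGauge i x = _
    rw [CatQG.BubbleParams.cyclicGauge, CatQG.BubbleParams.ratio]
    simp only [hne, ite_not]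
    split_ifs <;> simp
  · change (B.cyclicGauge i (x + D.α i) : 𝕜)⁻¹ = _
    rw [B.cyclicGauge_add_self]
    split_ifs <;> simp
  · change (B.cyclicGauge i x : 𝕜) = _
    rw [CatQG.BubbleParams.cyclicGauge]
    split_ifs <;> simp
  -- The quotient contributes `c⁻¹ / c⁻` in terms of values at `x`; for residues `0, 1` the gauge is
  -- `c⁻` and cancels the denominator.
  · change (B.cyclicGauge i (x + D.α i) : 𝕜) / B₀.ratio B i (x + D.α i) = _
    rw [B.cyclicGauge_add_self, CatQG.BubbleParams.ratio, Units.val_div_eq_div_val, hc]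
    simp only [hne, ite_not]
    split_ifs <;> simp only [hcm, Units.val_one] <;> field_simp
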